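/- **($CZ$ is transversal in stacked 3D surface codes.)** Let $d\ge 2$. *Lattice.* The rectified cubic lattice has as vertices the points of $\mathbb Z^3$ with exactly two odd coordinates. Its cells are octahedra (colour $g$), centred at the points $q$ with three odd coordinates and with the vertices at distance $1$ from $q$, and cuboctahedra, centred at the points $q$ with three even coordinates and with the vertices at distance $\sqrt2$ from $q$; a cuboctahedron is coloured $r$ if $q_1+q_2+q_3\equiv 2 \pmod 4$ and $b$ if $q_1+q_2+q_3\equiv 0\pmod 4$. The distance-$d$ lattice consists of the $n=3d^3-4d^2+2d$ vertices in the box $[1,2d-1]\times[1,2d-1]\times[0,2d-2]$; its cells are those centred in the box, truncated to these vertices. The two $r$-boundaries are the sets of vertices with $x=1$ and with $x=2d-1$, the two $b$-boundaries those with $y=1$ and with $y=2d-1$, the two $g$-boundaries those with $z=0$ and with $z=2d-2$. A face of the lattice is the set of common lattice vertices of two cells of the infinite lattice, at least one of them centred in the box, provided that it has at least three vertices; if the two cells have colours $c,c'$ it is a $cc'$-face. *Codes.* At each vertex there are three physical qubits, one for each of the codes $\mathcal{SC}_r,\mathcal{SC}_g,\mathcal{SC}_b$. The stabilizer group of $\mathcal{SC}_c$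 is generated by $X$-type operators on the $c$-cells and $Z$-type operators on the $c'c''$-faces, where $\{c,c',c''\}=\{r,g,b\}$, together with the following for $(c,\bar c)=(r,b)$ and $(b,r)$: $X$-type operators of $\mathcal{SC}_{c}$ on the faces of $\bar c$-cells that lie on $\bar c$-boundaries, and weight-two $Z$-type operators of $\mathcal{SC}_c$ on those edges of the faces of $c$-cells lying on $c$-boundaries that belong to a $\bar c g$-face of the infinite lattice. The code space of the stack is the space of all states of the $3n$ qubits that are fixed by all these operators. *Encoded states.* For each colour $c$ choose one of the two $c$-boundaries $B_c$; the canonical $\overline X_c$ acts with $X$ on every $\mathcal{SC}_c$-qubit of $B_c$. Let $G_0^c\subseteq\mathbb F_2^n$ be the span of the supports of the $X$ generators of $\mathcal{SC}_c$, let $X^c$ be the indicator vector of $B_c$, and let $G_1^c=X^c+G_0^c$. Put $|\overline{\alpha}\rangle_c=|G^c_\alpha|^{-1/2}\sum_{w\in G^c_\alpha}|w\rangle_c$ for $\alpha\in\{0,1\}$, and $|\overline{\alpha\beta\gamma}\rangle=|\overline\alpha\rangle_r|\overline\beta\rangle_g|\overline\gamma\rangle_b$. *Claim.* The eight states $|\overline{\alpha\beta\gamma}\rangle$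 form an orthonormal basis of the code space of the stack, so that the stack encodes three qubits, labelled $r,g,b$. For any three distinct colours $c,c',c''$, let $\overline{CZ}_{cc'}$ be the tensor product, over all vertices $v\in B_{c''}$, of the $CZ$ gates between the $\mathcal{SC}_c$-qubit and the $\mathcal{SC}_{c'}$-qubit at $v$, with the identity on all other qubits. Then $\overline{CZ}_{cc'}$ implements the logical $CZ$ between the encoded qubits $c$ and $c'$: for every three-qubit state $\varphi=\sum\varphi_{\alpha\beta\gamma}|\alpha\beta\gamma\rangle$ with encoding $\overline\varphi=\sum\varphi_{\alpha\beta\gamma}|\overline{\alpha\beta\gamma}\rangle$, $$\overline{CZ}_{cc'}\,\overline{\varphi}=\overline{CZ_{cc'}\,\varphi}.$$ -/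

import Mathlib

namespace StackedCode

/-! ## Qubits, gates and Pauli operators -/

section Qubits

variable {ι : Type} [Fintype ι] [DecidableEq ι]

/-- Pure states of a register of qubits labelled by `ι`: amplitudes in the computational basis,
whose elements are the bit strings `ι → ZMod 2`. -/
abbrev QState (ι : Type) [Fintype ι] [DecidableEq ι] : Type := EuclideanSpace ℂ (ι → ZMod 2)

/-- The computational basis state `|w⟩`. -/
noncomputable def ket (w : ι → ZMod 2) : QState ι := EuclideanSpace.single w 1

/-- The operator `|x⟩ ↦ f x • |x⟩`. -/
noncomputable def diagonalOp (f : (ι → ZMod 2) → ℂ) : QState ι →ₗ[ℂ] QState ι where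
  toFun ψ := WithLp.toLp 2 (fun x => f x * ψ x)
  map_add' ψ φ := by ext x; simp [mul_add]
  map_smul' a ψ := by ext x; simp [mul_left_comm]

/-- The two-qubit gate `CZ` on the qubits `i` and `j`, tensored with the identity on all other
qubits. -/
noncomputable def czGate (i j : ι) : QState ι →ₗ[ℂ] QState ι :=
  diagonalOp (fun x => if x i = 1 ∧ x j = 1 then -1 else 1)

theorem czGate_commute (i j k l : ι) : Commute (czGate i j) (czGate k l) := by
  refine LinearMap.ext fun ψ => ?_
  ext x
  simp only [czGate, diagonalOp, Module.End.mul_apply, LinearMap.coe_mk, AddHom.coe_mk]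
  ring

/-- The bit string with support `s`. -/
def indicator (s : Finset ι) : ι → ZMod 2 := fun i => if i ∈ s then 1 else 0

/-- The tensor product of Pauli `X` operators on the qubits in `s`: it maps `|x⟩` to
`|x + indicator s⟩`. -/
noncomputable def pauliX (s : Finset ι) : QState ι →ₗ[ℂ] QState ι where
  toFun ψ := WithLp.toLp 2 (fun x => ψ (x + indicator s))
  map_add' ψ φ := by ext x; simp
  map_smul' a ψ := by ext x; simp

/-- The tensor product of Pauli `Z` operators on the qubits in `s`. -/
noncomputable def pauliZ (s : Finset ι) : QState ι →ₗ[ℂ] QState ι :=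
  diagonalOp (fun x => ∏ i ∈ s, if x i = 1 then -1 else 1)

end Qubits

/-! ## The rectified cubic lattice -/

/-- The three colours, which label both the cells of the lattice and the three codes. -/
inductive Colour
  | r | g | b
  deriving DecidableEq

instance : Fintype Colour where
  elems := {.r, .g, .b}
  complete c := by cases c <;> simp

abbrev Pt : Type := ℤ × ℤ × ℤ

def sqDist (p q : Pt) : ℤ :=
  (p.1 - q.1) ^ 2 + (p.2.1 - q.2.1) ^ 2 + (p.2.2 - q.2.2) ^ 2

/-- The vertices of the infinite rectified cubic lattice are the centres of the faces of the
cubes of side 2 with corners in `(2ℤ)³`, that is, the integer points with exactly two odd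
coordinates. -/
def IsLatticePoint (p : Pt) : Prop :=
  (Odd p.1 ∧ Odd p.2.1 ∧ Even p.2.2) ∨ (Odd p.1 ∧ Even p.2.1 ∧ Odd p.2.2) ∨
    (Even p.1 ∧ Odd p.2.1 ∧ Odd p.2.2)

instance : DecidablePred IsLatticePoint := fun p => by
  unfold IsLatticePoint; infer_instance

/-- Centres of the cells of the infinite lattice. The `g`-cells are octahedra, centred at the
centres of the cubes; the `r`-cells and the `b`-cells are cuboctahedra, centred at the corners of
the cubes, with colours alternating between neighbouring corners. -/
def IsCentre : Colour → Pt → Prop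
  | .g, q => Odd q.1 ∧ Odd q.2.1 ∧ Odd q.2.2
  | .r, q => Even q.1 ∧ Even q.2.1 ∧ Even q.2.2 ∧ (q.1 + q.2.1 + q.2.2) % 4 = 2
  | .b, q => Even q.1 ∧ Even q.2.1 ∧ Even q.2.2 ∧ (q.1 + q.2.1 + q.2.2) % 4 = 0

/-- The squared circumradius of the cells of each colour. -/
def radiusSq : Colour → ℤ
  | .g => 1
  | .r => 2
  | .b => 2

/-- The cube that the lattice of distance `d` fills. Its bottom and top faces `z = 0` and
`z = 2d - 2` slice a layer of cuboctahedra in half, its other four faces run between layers of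
cuboctahedra. -/
def InBox (d : ℕ) (p : Pt) : Prop :=
  (1 ≤ p.1 ∧ p.1 ≤ 2 * d - 1) ∧ (1 ≤ p.2.1 ∧ p.2.1 ≤ 2 * d - 1) ∧
    (0 ≤ p.2.2 ∧ p.2.2 ≤ 2 * d - 2)

/-- The set of vertices of the lattice of distance `d`. -/
noncomputable def vertexSet (d : ℕ) : Finset Pt :=
  (Finset.Icc (1 : ℤ) (2 * d - 1) ×ˢ
    (Finset.Icc (1 : ℤ) (2 * d - 1) ×ˢ Finset.Icc (0 : ℤ) (2 * d - 2))).filter IsLatticePoint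

abbrev Vertex (d : ℕ) : Type := {p : Pt // p ∈ vertexSet d}

/-- The vertices, in the lattice of distance `d`, of the cell with colour `c` and centre `q`.
Cells at the boundary may be truncated. -/
noncomputable def cell (d : ℕ) (c : Colour) (q : Pt) : Finset (Vertex d) :=
  Finset.univ.filter fun v => sqDist v.1 q = radiusSq c

/-- The vertices on one of the two `c`-boundaries; `side` selects one of two opposite ones. The
`r`-boundaries are the left and right, the `b`-boundaries the front and back, and the
`g`-boundaries the bottom and top face of the cube. -/
noncomputable def boundary (d : ℕ) : Colour → Bool → Finset (Vertex d)
  | .r, side => Finset.univ.filter fun v => v.1.1 = if side then 2 * (d : ℤ) - 1 else 1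
  | .b, side => Finset.univ.filter fun v => v.1.2.1 = if side then 2 * (d : ℤ) - 1 else 1
  | .g, side => Finset.univ.filter fun v => v.1.2.2 = if side then 2 * (d : ℤ) - 2 else 0

/-- The (possibly truncated) `c`-cells of the lattice. -/
def cells (d : ℕ) (c : Colour) : Set (Finset (Vertex d)) :=
  {s | ∃ q, InBox d q ∧ IsCentre c q ∧ s = cell d c q}

/-- The (possibly truncated) faces of the lattice whose colours are `c` and `c'`. A face lies in
two cells of the infinite lattice; a face on the boundary may lie in only one cell of the finite
lattice, and then gets the colours that it has in the infinite lattice. -/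
def faces (d : ℕ) (c c' : Colour) : Set (Finset (Vertex d)) :=
  {f | ∃ q q', IsCentre c q ∧ IsCentre c' q' ∧ (InBox d q ∨ InBox d q') ∧
    f = cell d c q ∩ cell d c' q' ∧ 3 ≤ f.card}

/-- The faces of `c`-cells of the lattice that lie on `c`-boundaries. -/
def boundaryFaces (d : ℕ) (c : Colour) : Set (Finset (Vertex d)) :=
  {f | ∃ q side, InBox d q ∧ IsCentre c q ∧ f = cell d c q ∩ boundary d c side ∧ 3 ≤ f.card}

/-- The edges of the faces in `boundaryFaces d c` that are part of a face of the infinite lattice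
with colours `c'` and `g`. -/
def boundaryEdges (d : ℕ) (c c' : Colour) : Set (Finset (Vertex d)) :=
  {e | ∃ f ∈ boundaryFaces d c, ∃ q q', IsCentre c' q ∧ IsCentre .g q' ∧
    e = f ∩ (cell d c' q ∩ cell d .g q') ∧ e.card = 2}

/-! ## The three surface codes -/

/-- Supports of the `X` stabilizer generators of the code with colour `c`: the `c`-cells and, for
`r` and `b`, the faces of the cuboctahedra of the other colour on the boundaries of that other
colour (flattened `c`-cells). -/
def xGenerators (d : ℕ) : Colour → Set (Finset (Vertex d))
  | .r => cells d .r ∪ boundaryFaces d .b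
  | .g => cells d .g
  | .b => cells d .b ∪ boundaryFaces d .r

/-- Supports of the `Z` stabilizer generators of the code with colour `c`: the faces with the two
other colours and, for `r` and `b`, the weight two generators on the `c`-boundaries (flattened
faces). -/
def zGenerators (d : ℕ) : Colour → Set (Finset (Vertex d))
  | .r => faces d .b .g ∪ boundaryEdges d .r .b
  | .g => faces d .r .b
  | .b => faces d .r .g ∪ boundaryEdges d .b .r

/-- The physical qubits of the stack: one per code at every vertex. -/
abbrev Qubit (d : ℕ) : Type := Colour × Vertex d

/-- The code space of the stack: the states that are fixed by all stabilizers of all three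
codes. -/
noncomputable def codeSpace (d : ℕ) : Submodule ℂ (QState (Qubit d)) :=
  ⨅ c : Colour,
    (⨅ s ∈ xGenerators d c, LinearMap.eqLocus (pauliX ({c} ×ˢ s)) LinearMap.id) ⊓
    (⨅ s ∈ zGenerators d c, LinearMap.eqLocus (pauliZ ({c} ×ˢ s)) LinearMap.id)

/-- The binary span of the `X` stabilizer generators of the code with colour `c`. -/
def xSpan (d : ℕ) (c : Colour) : Submodule (ZMod 2) (Vertex d → ZMod 2) :=
  Submodule.span (ZMod 2) (indicator '' xGenerators d c)

open Classical in
/-- The coset `α X + xSpan d c`, where `X` is the support of the canonical logical `X` operator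
on the chosen `c`-boundary. -/
noncomputable def coset (d : ℕ) (c : Colour) (side : Bool) (α : ZMod 2) :
    Finset (Vertex d → ZMod 2) :=
  Finset.univ.filter fun w => ∃ v ∈ xSpan d c, w = α • indicator (boundary d c side) + v

/-- The encoded computational basis state `|α⟩` of the code with colour `c`: the uniform
superposition of the bit strings in `coset d c side α`. -/
noncomputable def codeKet (d : ℕ) (c : Colour) (side : Bool) (α : ZMod 2) : QState (Vertex d) :=
  ((Real.sqrt (coset d c side α).card : ℂ))⁻¹ • ∑ w ∈ coset d c side α, ket w

/-- The encoded computational basis state of the stack, the tensor product of the basis states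
`codeKet d c (side c) (α c)` of the three codes. -/
noncomputable def stackKet (d : ℕ) (side : Colour → Bool) (α : Colour → ZMod 2) :
    QState (Qubit d) :=
  WithLp.toLp 2 fun x => ∏ c, codeKet d c (side c) (α c) fun v => x (c, v)

/-- The linear map that encodes a state of three qubits (labelled by the colours) in the stack. -/
noncomputable def encode (d : ℕ) (side : Colour → Bool) :
    QState Colour →ₗ[ℂ] QState (Qubit d) where
  toFun φ := ∑ α : Colour → ZMod 2, φ α • stackKet d side α
  map_add' φ ψ := by simp [add_smul, Finset.sum_add_distrib]
  map_smul' a φ := by simp [mul_smul, Finset.smul_sum]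

/-- The tensor product of `CZ` gates on all pairs of qubits from the codes `c` and `c'` that share
a vertex in `s`. -/
noncomputable def transversalCZ (d : ℕ) (c c' : Colour) (s : Finset (Vertex d)) :
    QState (Qubit d) →ₗ[ℂ] QState (Qubit d) :=
  s.noncommProd (fun v => czGate ((c, v) : Qubit d) (c', v))
    (fun _ _ _ _ _ => czGate_commute _ _ _ _)

end StackedCode

open StackedCode

namespace StackedCode

/-! Fix a colour `c`. Every lattice vertex lies in exactly two `c`-cells of the infinite lattice, so
it can be regarded as an edge joining two `c`-centres; the centres form a cubic lattice for `g` and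
a face-centred cubic one for `r` and `b`. The boundary faces used as `X` generators are flattened
`c`-cells centred outside the box, so all `X` generators are vertex stars of this graph
(`mem_xGenerators`), and the `Z` generators are its plaquettes, squares or triangles, possibly
truncated. A bit string orthogonal to all `Z` generators is a cocycle, the span of the `X`
generators consists of coboundaries, and the cohomology relative to the two `c`-boundaries is
one-dimensional.

Explicit potentials show that it is at most one-dimensional (`exists_zigzag_potential` for `r` and
`b`, `exists_column_potential` for `g`, combined in `closed_complete`). That the indicator of a
`c`-boundary is a nontrivial class follows by pairing it with the line where boundaries of the other
two colours meet (`boundary_notMem_xSpan`). Hence the closed strings are the disjoint union of the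
cosets `G_0` and `G_1` (`closed_iff`). A code state is supported on closed strings by its `Z`
stabilizers and constant on products of cosets by its `X` stabilizers, which gives the orthonormal
basis.

The gate multiplies the basis string `x` by the sign of the sum over the `c''`-boundary of the
products of its `c`- and `c'`-components. This form is bilinear. Generators of two different colours
share an even number of vertices on a boundary of the third colour, a generator meets the line
shared by boundaries of the two other colours evenly, and three boundaries of different colours meet
in one corner. So the sum is `α c * α c'` on the cosets (`pairing_coset`), the phase of the logical
gate. All evenness statements come from point reflections without fixed points
(`card_eq_zero_of_reflection`). -/

/-! ### Cells as unit neighbourhoods of their centres, and a uniform description of the `X`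
generators. -/

/-- Two points are near if their coordinates differ by at most one. -/
def Near (p q : Pt) : Prop :=
  (q.1 - 1 ≤ p.1 ∧ p.1 ≤ q.1 + 1) ∧ (q.2.1 - 1 ≤ p.2.1 ∧ p.2.1 ≤ q.2.1 + 1) ∧
    (q.2.2 - 1 ≤ p.2.2 ∧ p.2.2 ≤ q.2.2 + 1)

instance (p q : Pt) : Decidable (Near p q) := by unfold Near; infer_instance

theorem isLatticePoint_iff (p : Pt) : IsLatticePoint p ↔
    (p.1 % 2 = 1 ∧ p.2.1 % 2 = 1 ∧ p.2.2 % 2 = 0) ∨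
    (p.1 % 2 = 1 ∧ p.2.1 % 2 = 0 ∧ p.2.2 % 2 = 1) ∨
    (p.1 % 2 = 0 ∧ p.2.1 % 2 = 1 ∧ p.2.2 % 2 = 1) := by
  simp only [IsLatticePoint, Int.odd_iff, Int.even_iff]

theorem mem_vertexSet (d : ℕ) (p : Pt) : p ∈ vertexSet d ↔
    ((1 ≤ p.1 ∧ p.1 ≤ 2 * d - 1) ∧ (1 ≤ p.2.1 ∧ p.2.1 ≤ 2 * d - 1) ∧
      (0 ≤ p.2.2 ∧ p.2.2 ≤ 2 * d - 2)) ∧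
    ((p.1 % 2 = 1 ∧ p.2.1 % 2 = 1 ∧ p.2.2 % 2 = 0) ∨
    (p.1 % 2 = 1 ∧ p.2.1 % 2 = 0 ∧ p.2.2 % 2 = 1) ∨
    (p.1 % 2 = 0 ∧ p.2.1 % 2 = 1 ∧ p.2.2 % 2 = 1)) := by
  simp only [vertexSet, Finset.mem_filter, Finset.mem_product, Finset.mem_Icc, isLatticePoint_iff]

theorem isCentre_r (q : Pt) : IsCentre .r q ↔
    q.1 % 2 = 0 ∧ q.2.1 % 2 = 0 ∧ q.2.2 % 2 = 0 ∧ (q.1 + q.2.1 + q.2.2) % 4 = 2 := by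
  simp only [IsCentre, Int.even_iff]

theorem isCentre_b (q : Pt) : IsCentre .b q ↔
    q.1 % 2 = 0 ∧ q.2.1 % 2 = 0 ∧ q.2.2 % 2 = 0 ∧ (q.1 + q.2.1 + q.2.2) % 4 = 0 := by
  simp only [IsCentre, Int.even_iff]

theorem isCentre_g (q : Pt) : IsCentre .g q ↔
    q.1 % 2 = 1 ∧ q.2.1 % 2 = 1 ∧ q.2.2 % 2 = 1 := by
  simp only [IsCentre, Int.odd_iff]

theorem sq_sum_eq_of_near {x y z : ℤ} (hx : -1 ≤ x ∧ x ≤ 1) (hy : -1 ≤ y ∧ y ≤ 1)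
    (hz : -1 ≤ z ∧ z ≤ 1) : x ^ 2 + y ^ 2 + z ^ 2 = x % 2 + y % 2 + z % 2 := by
  obtain ⟨hx, hx'⟩ := hx
  obtain ⟨hy, hy'⟩ := hy
  obtain ⟨hz, hz'⟩ := hz
  interval_cases x <;> interval_cases y <;> interval_cases z <;> rfl

theorem abs_le_one_of_sq {x : ℤ} (h : x ^ 2 ≤ 2) : -1 ≤ x ∧ x ≤ 1 := by
  constructor <;> nlinarith

/-- If all coordinate differences are at most one, each square equals the parity of the difference,
so the squared distance counts the coordinates in which `p` and `q` differ in parity: two for an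
even centre, one for an odd centre. -/
theorem sqDist_eq_iff {c : Colour} {p q : Pt} (hp : IsLatticePoint p) (hq : IsCentre c q) :
    sqDist p q = radiusSq c ↔ Near p q := by
  rw [isLatticePoint_iff] at hp
  have hr : radiusSq c ≤ 2 := by cases c <;> decide
  constructor
  · intro h
    have h1 := sq_nonneg (p.1 - q.1)
    have h2 := sq_nonneg (p.2.1 - q.2.1)
    have h3 := sq_nonneg (p.2.2 - q.2.2)
    unfold sqDist at h
    have h1' := abs_le_one_of_sq (x := p.1 - q.1) (by omega)
    have h2' := abs_le_one_of_sq (x := p.2.1 - q.2.1) (by omega)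
    have h3' := abs_le_one_of_sq (x := p.2.2 - q.2.2) (by omega)
    unfold Near
    omega
  · intro h
    unfold Near at h
    unfold sqDist
    rw [sq_sum_eq_of_near (by omega) (by omega) (by omega)]
    cases c
    · rw [isCentre_r] at hq
      simp only [radiusSq]; omega
    · rw [isCentre_g] at hq
      simp only [radiusSq]; omega
    · rw [isCentre_b] at hq
      simp only [radiusSq]; omega

/-- The lattice vertices near a point. -/
noncomputable def nearSet (d : ℕ) (q : Pt) : Finset (Vertex d) :=
  Finset.univ.filter fun v => Near v.1 q

theorem mem_nearSet {d : ℕ} {q : Pt} {v : Vertex d} : v ∈ nearSet d q ↔ Near v.1 q := by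
  simp [nearSet]

theorem mem_boundary_r {d : ℕ} {side : Bool} {v : Vertex d} :
    v ∈ boundary d .r side ↔ v.1.1 = if side then 2 * (d : ℤ) - 1 else 1 := by
  simp [boundary]

theorem mem_boundary_b {d : ℕ} {side : Bool} {v : Vertex d} :
    v ∈ boundary d .b side ↔ v.1.2.1 = if side then 2 * (d : ℤ) - 1 else 1 := by
  simp [boundary]

theorem mem_boundary_g {d : ℕ} {side : Bool} {v : Vertex d} :
    v ∈ boundary d .g side ↔ v.1.2.2 = if side then 2 * (d : ℤ) - 2 else 0 := by
  simp [boundary]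

theorem isLatticePoint_of_vertex {d : ℕ} (v : Vertex d) : IsLatticePoint v.1 := by
  have h := v.2
  rw [mem_vertexSet] at h
  rw [isLatticePoint_iff]
  exact h.2

theorem cell_eq {d : ℕ} {c : Colour} {q : Pt} (hq : IsCentre c q) : cell d c q = nearSet d q := by
  ext v
  simp only [cell, nearSet, Finset.mem_filter, Finset.mem_univ, true_and]
  exact sqDist_eq_iff (isLatticePoint_of_vertex v) hq

/-- The centres of the `c`-cells, including the flattened ones outside the box. -/
def ValidCentre (d : ℕ) : Colour → Pt → Prop
  | .r, q => (2 ≤ q.1 ∧ q.1 ≤ 2 * d - 2) ∧ (0 ≤ q.2.1 ∧ q.2.1 ≤ 2 * d) ∧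
      (0 ≤ q.2.2 ∧ q.2.2 ≤ 2 * d - 2)
  | .b, q => (0 ≤ q.1 ∧ q.1 ≤ 2 * d) ∧ (2 ≤ q.2.1 ∧ q.2.1 ≤ 2 * d - 2) ∧
      (0 ≤ q.2.2 ∧ q.2.2 ≤ 2 * d - 2)
  | .g, q => InBox d q

theorem three_le_card {α : Type*} [DecidableEq α] {s : Finset α} {a b c : α} (ha : a ∈ s)
    (hb : b ∈ s) (hc : c ∈ s) (hab : a ≠ b) (hac : a ≠ c) (hbc : b ≠ c) : 3 ≤ s.card :=
  Finset.two_lt_card.2 ⟨a, ha, b, hb, c, hc, hab, hac, hbc⟩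

/-- A face of a cuboctahedron on its own boundary is also what the box leaves of the neighbouring
cuboctahedron of the other colour, centred beyond that boundary at coordinate `0` or `2 * d`.
Thereafter boundary generators need no separate treatment. -/
theorem mem_xGenerators {d : ℕ} (hd : 2 ≤ d) {c : Colour} {s : Finset (Vertex d)} :
    s ∈ xGenerators d c ↔ ∃ q, ValidCentre d c q ∧ IsCentre c q ∧ s = nearSet d q := by
  constructor
  · intro h
    cases c
    · rcases h with ⟨q, hb, hq, rfl⟩ | ⟨q, side, hb, hq, rfl, h3⟩
      · refine ⟨q, ?_, hq, cell_eq hq⟩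
        rw [isCentre_r] at hq
        unfold InBox at hb
        unfold ValidCentre
        omega
      · rw [cell_eq hq] at h3 ⊢
        rw [isCentre_b] at hq
        unfold InBox at hb
        obtain ⟨v, hv⟩ : (nearSet d q ∩ boundary d .b side).Nonempty := by
          rw [← Finset.card_pos]; omega
        simp only [mem_nearSet, mem_boundary_b, Finset.mem_inter, Near] at hv
        -- This is the mirror image of `q` in the boundary plane; the shift by two changes the
        -- colour.
        refine ⟨(q.1, if side then 2 * (d : ℤ) else 0, q.2.2), ?_, ?_, ?_⟩
        · unfold ValidCentre
          cases side <;> simp at hv ⊢ <;> omega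
        · rw [isCentre_r]
          cases side <;> simp at hv ⊢ <;> omega
        · ext u
          have hu := u.2
          rw [mem_vertexSet] at hu
          simp only [mem_nearSet, mem_boundary_b, Finset.mem_inter, Near]
          cases side <;> simp at hv ⊢ <;> omega
    · obtain ⟨q, hb, hq, rfl⟩ := h
      exact ⟨q, hb, hq, cell_eq hq⟩
    · rcases h with ⟨q, hb, hq, rfl⟩ | ⟨q, side, hb, hq, rfl, h3⟩
      · refine ⟨q, ?_, hq, cell_eq hq⟩
        rw [isCentre_b] at hq
        unfold InBox at hb
        unfold ValidCentre
        omega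
      · rw [cell_eq hq] at h3 ⊢
        rw [isCentre_r] at hq
        unfold InBox at hb
        obtain ⟨v, hv⟩ : (nearSet d q ∩ boundary d .r side).Nonempty := by
          rw [← Finset.card_pos]; omega
        simp only [mem_nearSet, mem_boundary_r, Finset.mem_inter, Near] at hv
        refine ⟨(if side then 2 * (d : ℤ) else 0, q.2.1, q.2.2), ?_, ?_, ?_⟩
        · unfold ValidCentre
          cases side <;> simp at hv ⊢ <;> omega
        · rw [isCentre_b]
          cases side <;> simp at hv ⊢ <;> omega
        · ext u
          have hu := u.2
          rw [mem_vertexSet] at hu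
          simp only [mem_nearSet, mem_boundary_r, Finset.mem_inter, Near]
          cases side <;> simp at hv ⊢ <;> omega
  · rintro ⟨q, hv, hq, rfl⟩
    obtain ⟨x, y, z⟩ := q
    cases c
    · have hq' := hq
      rw [isCentre_r] at hq'
      simp only [ValidCentre] at hv hq'
      by_cases hy : 2 ≤ y ∧ y ≤ 2 * d - 2
      · refine Or.inl ⟨_, ?_, hq, (cell_eq hq).symm⟩
        simp only [InBox]; omega
      · obtain ⟨side, hs⟩ : ∃ side : Bool, y = if side then 2 * (d : ℤ) else 0 := by
          by_cases h0 : y = 0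
          · exact ⟨false, by simp [h0]⟩
          · exact ⟨true, by simp; omega⟩
        -- At the bottom or top the flattened cell keeps only three vertices; `e` is a vertical
        -- direction that stays in the box.
        obtain ⟨e, he, hez⟩ : ∃ e : ℤ, (e = 1 ∨ e = -1) ∧ 0 ≤ z + e ∧ z + e ≤ 2 * d - 2 := by
          by_cases h0 : z = 0
          · exact ⟨1, by omega⟩
          · exact ⟨-1, by omega⟩
        obtain ⟨y', hy'⟩ : ∃ t : ℤ, t = if side then 2 * (d : ℤ) - 2 else 2 := ⟨_, rfl⟩
        obtain ⟨y1, hy1⟩ : ∃ t : ℤ, t = if side then 2 * (d : ℤ) - 1 else 1 := ⟨_, rfl⟩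
        have hyy : (y = 0 ∧ y' = 2 ∧ y1 = 1) ∨
            (y = 2 * d ∧ y' = 2 * d - 2 ∧ y1 = 2 * d - 1) := by
          cases side <;> simp at hs hy' hy1 <;> omega
        have hc : IsCentre .b (x, y', z) := by
          rw [isCentre_b]; simp only; omega
        have heq : nearSet d (x, y, z) = cell d .b (x, y', z) ∩ boundary d .b side := by
          rw [cell_eq hc]
          ext u
          have hu := u.2
          rw [mem_vertexSet] at hu
          simp only [mem_nearSet, mem_boundary_b, Finset.mem_inter, Near, ← hy1]
          omega
        refine Or.inr ⟨(x, y', z), side, ?_, hc, heq, ?_⟩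
        · simp only [InBox]; omega
        · refine three_le_card (a := ⟨(x - 1, y1, z), ?_⟩) (b := ⟨(x + 1, y1, z), ?_⟩)
            (c := ⟨(x, y1, z + e), ?_⟩) ?_ ?_ ?_ ?_ ?_ ?_
          all_goals
            simp only [mem_vertexSet, mem_nearSet, Near, ne_eq, Subtype.mk.injEq, Prod.mk.injEq]
          all_goals omega
    · exact ⟨_, hv, hq, (cell_eq hq).symm⟩
    · have hq' := hq
      rw [isCentre_b] at hq'
      simp only [ValidCentre] at hv hq'
      by_cases hy : 2 ≤ x ∧ x ≤ 2 * d - 2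
      · refine Or.inl ⟨_, ?_, hq, (cell_eq hq).symm⟩
        simp only [InBox]; omega
      · obtain ⟨side, hs⟩ : ∃ side : Bool, x = if side then 2 * (d : ℤ) else 0 := by
          by_cases h0 : x = 0
          · exact ⟨false, by simp [h0]⟩
          · exact ⟨true, by simp; omega⟩
        obtain ⟨e, he, hez⟩ : ∃ e : ℤ, (e = 1 ∨ e = -1) ∧ 0 ≤ z + e ∧ z + e ≤ 2 * d - 2 := by
          by_cases h0 : z = 0
          · exact ⟨1, by omega⟩
          · exact ⟨-1, by omega⟩
        obtain ⟨x', hx'⟩ : ∃ t : ℤ, t = if side then 2 * (d : ℤ) - 2 else 2 := ⟨_, rfl⟩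
        obtain ⟨x1, hx1⟩ : ∃ t : ℤ, t = if side then 2 * (d : ℤ) - 1 else 1 := ⟨_, rfl⟩
        have hxx : (x = 0 ∧ x' = 2 ∧ x1 = 1) ∨
            (x = 2 * d ∧ x' = 2 * d - 2 ∧ x1 = 2 * d - 1) := by
          cases side <;> simp at hs hx' hx1 <;> omega
        have hc : IsCentre .r (x', y, z) := by
          rw [isCentre_r]; simp only; omega
        have heq : nearSet d (x, y, z) = cell d .r (x', y, z) ∩ boundary d .r side := by
          rw [cell_eq hc]
          ext u
          have hu := u.2
          rw [mem_vertexSet] at hu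
          simp only [mem_nearSet, mem_boundary_r, Finset.mem_inter, Near, ← hx1]
          omega
        refine Or.inr ⟨(x', y, z), side, ?_, hc, heq, ?_⟩
        · simp only [InBox]; omega
        · refine three_le_card (a := ⟨(x1, y - 1, z), ?_⟩) (b := ⟨(x1, y + 1, z), ?_⟩)
            (c := ⟨(x1, y, z + e), ?_⟩) ?_ ?_ ?_ ?_ ?_ ?_
          all_goals
            simp only [mem_vertexSet, mem_nearSet, Near, ne_eq, Subtype.mk.injEq, Prod.mk.injEq]
          all_goals omega

/-! ### Potentials for the `r`- and `b`-codes, built layer by layer between the two boundaries. -/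

/-- The values at the `ρ`-coloured points of a layer of even height `2 * k` of a potential for `W`
that vanishes at height zero. -/
def zigzagPotential (W : ℤ → ℤ → ℤ → ZMod 2) : ℕ → ℤ → ℤ → ZMod 2
  | 0, _, _ => 0
  | k + 1, t, z =>
    -- A point is reached from the layer below through its neighbour at `t - 2`, except at the edge
    -- `t = 0`, where only `t + 2` is available.
    if 2 ≤ t then W (2 * k + 1) (t - 1) z + zigzagPotential W k (t - 2) z
    else W (2 * k + 1) (t + 1) z + zigzagPotential W k (t + 2) z

theorem zmod_two_eq_zero : (2 : ZMod 2) = 0 := rfl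

section Zigzag

variable {d : ℕ} {ρ : ℤ} {W : ℤ → ℤ → ℤ → ZMod 2}

/-- The function `W` on the vertices sums to zero over every triangle, truncated or not, between
an octahedron and a cuboctahedron whose colour is not `ρ`. -/
def TriangleClosed (d : ℕ) (ρ : ℤ) (W : ℤ → ℤ → ℤ → ZMod 2) : Prop :=
  ∀ a t z s₁ s₂ s₃ : ℤ, a % 2 = 0 → t % 2 = 0 → z % 2 = 0 → (a + t + z) % 4 = (ρ + 2) % 4 →
    0 ≤ a → a ≤ 2 * d → 2 ≤ t → t ≤ 2 * d - 2 → 0 ≤ z → z ≤ 2 * d - 2 →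
    (s₁ = 1 ∨ s₁ = -1) → (s₂ = 1 ∨ s₂ = -1) → (s₃ = 1 ∨ s₃ = -1) →
    1 ≤ a + s₁ → a + s₁ ≤ 2 * d - 1 → 0 ≤ z + s₃ → z + s₃ ≤ 2 * d - 2 →
    W a (t + s₂) (z + s₃) + W (a + s₁) t (z + s₃) + W (a + s₁) (t + s₂) z = 0

/-- `F` is a potential for `W` in the layer `a`. -/
def LayerPotential (d : ℕ) (ρ : ℤ) (W : ℤ → ℤ → ℤ → ZMod 2) (a : ℤ) (F : ℤ → ℤ → ZMod 2) :
    Prop :=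
  ∀ t z s₂ s₃ : ℤ, t % 2 = 0 → z % 2 = 0 → (a + t + z) % 4 = (ρ + 2) % 4 →
    (s₂ = 1 ∨ s₂ = -1) → (s₃ = 1 ∨ s₃ = -1) → 1 ≤ t + s₂ → t + s₂ ≤ 2 * d - 1 →
    0 ≤ z + s₃ → z + s₃ ≤ 2 * d - 2 →
    W a (t + s₂) (z + s₃) = F (t + 2 * s₂) z + F t (z + 2 * s₃)

/-- `F` and `F'` are a potential for the values of `W` between the layers `a` and `a + 2`. -/
def StepPotential (d : ℕ) (ρ : ℤ) (W : ℤ → ℤ → ℤ → ZMod 2) (a : ℤ) (F F' : ℤ → ℤ → ZMod 2) :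
    Prop :=
  ∀ t z s : ℤ, t % 2 = 0 → z % 2 = 0 → (a + 2 + t + z) % 4 = ρ % 4 →
    0 ≤ t → t ≤ 2 * d → 0 ≤ z → z ≤ 2 * d - 2 → (s = 1 ∨ s = -1) →
    ((1 ≤ t + s → t + s ≤ 2 * d - 1 → W (a + 1) (t + s) z = F (t + 2 * s) z + F' t z) ∧
    (2 ≤ t → t ≤ 2 * d - 2 → 0 ≤ z + s → z + s ≤ 2 * d - 2 →
      W (a + 1) t (z + s) = F t (z + 2 * s) + F' t z))

/-- A point of the next layer has up to four neighbours in this layer. The triangles on the far side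
of layer `2 * k` show that a `t`-neighbour and a `z`-neighbour give it the same value; since one of
them defines the value, all agree. -/
theorem stepPotential_zigzag (hd : 2 ≤ d) (hρ : ρ % 2 = 0) (hW : TriangleClosed d ρ W) {k : ℕ}
    (hk : k < d)
    (hL : LayerPotential d ρ W (2 * k) (zigzagPotential W k)) :
    StepPotential d ρ W (2 * k) (zigzagPotential W k) (zigzagPotential W (k + 1)) := by
  have tri : ∀ t z s₂ s₃ : ℤ, t % 2 = 0 → z % 2 = 0 → (2 * k + 2 + t + z) % 4 = ρ % 4 →
      2 ≤ t → t ≤ 2 * d - 2 → 0 ≤ z → z ≤ 2 * d - 2 → (s₂ = 1 ∨ s₂ = -1) →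
      (s₃ = 1 ∨ s₃ = -1) → 0 ≤ z + s₃ → z + s₃ ≤ 2 * d - 2 →
      W (2 * k + 1) t (z + s₃) + zigzagPotential W k t (z + 2 * s₃) =
        W (2 * k + 1) (t + s₂) z + zigzagPotential W k (t + 2 * s₂) z := by
    intro t z s₂ s₃ ht hz hr ht1 ht2 hz1 hz2 h2 h3 hz3 hz4
    have h := hW (2 * k) t z 1 s₂ s₃ (by omega) ht hz (by omega) (by omega) (by omega) ht1 ht2
      hz1 hz2 (Or.inl rfl) h2 h3 (by omega) (by omega) hz3 hz4
    rw [hL t z s₂ s₃ ht hz (by omega) h2 h3 (by omega) (by omega) hz3 hz4] at h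
    linear_combination h - (zigzagPotential W k (t + 2 * s₂) z +
      W (2 * k + 1) (t + s₂) z) * zmod_two_eq_zero
  have can : ∀ t z : ℤ, 2 ≤ t → W (2 * k + 1) (t + -1) z =
      zigzagPotential W k (t + 2 * -1) z + zigzagPotential W (k + 1) t z := by
    intro t z ht
    rw [zigzagPotential, if_pos ht]
    rw [show t + -1 = t - 1 by ring, show t + 2 * -1 = t - 2 by ring]
    linear_combination - zigzagPotential W k (t - 2) z * zmod_two_eq_zero
  have two : ∀ t z s : ℤ, t % 2 = 0 → z % 2 = 0 → (2 * k + 2 + t + z) % 4 = ρ % 4 →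
      2 ≤ t → t ≤ 2 * d - 2 → 0 ≤ z → z ≤ 2 * d - 2 → (s = 1 ∨ s = -1) → 0 ≤ z + s →
      z + s ≤ 2 * d - 2 → W (2 * k + 1) t (z + s) =
        zigzagPotential W k t (z + 2 * s) + zigzagPotential W (k + 1) t z := by
    intro t z s ht hz hr ht1 ht2 hz1 hz2 hs hz3 hz4
    have h := tri t z (-1) s ht hz hr ht1 ht2 hz1 hz2 (Or.inr rfl) hs hz3 hz4
    rw [can t z ht1] at h
    linear_combination h + (zigzagPotential W k (t + 2 * -1) z -
      zigzagPotential W k t (z + 2 * s)) * zmod_two_eq_zero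
  intro t z s ht hz hr ht1 ht2 hz1 hz2 hs
  refine ⟨fun h1 h2 => ?_, fun h1 h2 h3 h4 => two t z s ht hz hr h1 h2 hz1 hz2 hs h3 h4⟩
  rcases hs with rfl | rfl
  · by_cases h0 : t = 0
    · rw [zigzagPotential, if_neg (by omega), mul_one]
      linear_combination - zigzagPotential W k (t + 2) z * zmod_two_eq_zero
    -- The two `t`-neighbours share no triangle; they are compared through a `z`-neighbour inside
    -- the box.
    · obtain ⟨e, he, he1, he2⟩ : ∃ e : ℤ, (e = 1 ∨ e = -1) ∧ 0 ≤ z + e ∧ z + e ≤ 2 * d - 2 := by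
        by_cases h0 : z = 0
        · exact ⟨1, by omega⟩
        · exact ⟨-1, by omega⟩
      have h := tri t z 1 e ht hz hr (by omega) (by omega) hz1 hz2 (Or.inl rfl) he he1 he2
      rw [two t z e ht hz hr (by omega) (by omega) hz1 hz2 he he1 he2] at h
      linear_combination -h + (zigzagPotential W k t (z + 2 * e) -
        zigzagPotential W k (t + 2 * 1) z) * zmod_two_eq_zero
  · exact can t z (by omega)

/-- A triangle on the near side of the new layer has one edge in that layer and two edges to a
common point of the previous layer. The two step equations for the latter add up to the equation for
the former. -/
theorem layerPotential_zigzag_succ (hd : 2 ≤ d) (hρ : ρ % 2 = 0) (hW : TriangleClosed d ρ W)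
    {k : ℕ} (hk : k < d)
    (hS : StepPotential d ρ W (2 * k) (zigzagPotential W k) (zigzagPotential W (k + 1))) :
    LayerPotential d ρ W (2 * (k + 1 : ℕ)) (zigzagPotential W (k + 1)) := by
  have key : ∀ t z s₂ s₃ : ℤ, t % 2 = 0 → z % 2 = 0 →
      (2 * k + 2 + t + z) % 4 = (ρ + 2) % 4 →
      (s₂ = 1 ∨ s₂ = -1) → (s₃ = 1 ∨ s₃ = -1) → 2 ≤ t → t ≤ 2 * d - 2 →
      1 ≤ t + s₂ → t + s₂ ≤ 2 * d - 1 →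
      0 ≤ z + s₃ → z + s₃ ≤ 2 * d - 2 →
      W (2 * k + 2) (t + s₂) (z + s₃) =
        zigzagPotential W (k + 1) (t + 2 * s₂) z + zigzagPotential W (k + 1) t (z + 2 * s₃) := by
    intro t z s₂ s₃ ht hz hr h2 h3 ht1 ht2 ht3 ht4 hz1 hz2
    have h := hW (2 * k + 2) t z (-1) s₂ s₃ (by omega) ht hz (by omega) (by omega) (by omega)
      ht1 ht2 (by omega) (by omega) (Or.inr rfl) h2 h3 (by omega) (by omega) hz1 hz2
    rw [show (2 * k + 2 + -1 : ℤ) = 2 * k + 1 by ring] at h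
    have e1 := (hS (t + 2 * s₂) z (-s₂) (by omega) hz (by omega) (by omega) (by omega)
      (by omega) (by omega) (by omega)).1 (by omega) (by omega)
    have e2 := (hS t (z + 2 * s₃) (-s₃) ht (by omega) (by omega) (by omega) (by omega)
      (by omega) (by omega) (by omega)).2 (by omega) (by omega) (by omega) (by omega)
    rw [show t + 2 * s₂ + -s₂ = t + s₂ by ring, show t + 2 * s₂ + 2 * -s₂ = t by ring] at e1
    rw [show z + 2 * s₃ + -s₃ = z + s₃ by ring, show z + 2 * s₃ + 2 * -s₃ = z by ring] at e2
    rw [e1, e2] at h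
    linear_combination h - (zigzagPotential W k t z + zigzagPotential W (k + 1) (t + 2 * s₂) z +
      zigzagPotential W (k + 1) t (z + 2 * s₃)) * zmod_two_eq_zero
  intro t z s₂ s₃ ht hz hr h2 h3 ht1 ht2 hz1 hz2
  rw [show (2 * (k + 1 : ℕ) : ℤ) = 2 * k + 2 by push_cast; ring] at hr ⊢
  by_cases hin : 2 ≤ t ∧ t ≤ 2 * d - 2
  · exact key t z s₂ s₃ ht hz hr h2 h3 hin.1 hin.2 ht1 ht2 hz1 hz2
  -- An edge within a layer lies beside two centres of the other colour. If the given one has `t =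
  -- 0` or `t = 2 * d`, where `TriangleClosed` gives nothing, the diagonally opposite one is used.
  · have h := key (t + 2 * s₂) (z + 2 * s₃) (-s₂) (-s₃) (by omega) (by omega) (by omega)
      (by omega) (by omega) (by omega) (by omega) (by omega) (by omega) (by omega) (by omega)
    rw [show t + 2 * s₂ + -s₂ = t + s₂ by ring, show t + 2 * s₂ + 2 * -s₂ = t by ring,
      show z + 2 * s₃ + -s₃ = z + s₃ by ring, show z + 2 * s₃ + 2 * -s₃ = z by ring] at h
    rw [h, add_comm]

theorem layerPotential_zigzag (hd : 2 ≤ d) (hρ : ρ % 2 = 0) (hW : TriangleClosed d ρ W)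
    (h0 : ∀ t z, W 0 t z = 0) :
    ∀ k : ℕ, k ≤ d → LayerPotential d ρ W (2 * k) (zigzagPotential W k) := by
  intro k
  induction k with
  | zero =>
    intro _ t z s₂ s₃ _ _ _ _ _ _ _ _ _
    simp [zigzagPotential, h0]
  | succ k ih =>
    intro hk
    exact layerPotential_zigzag_succ hd hρ hW (by omega)
      (stepPotential_zigzag hd hρ hW (by omega) (ih (by omega)))

/-- Diagonal moves connect all points of one colour in a layer: descend to `z = 0`, then shift `t`
by four with one move up and one move down. The second part needs height `2`, which `2 ≤ d`
provides. -/
theorem eq_of_diagonal_eq {G : ℤ → ℤ → ZMod 2} (hd : 2 ≤ d)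
    (hG : ∀ t z s₂ s₃ : ℤ, t % 2 = 0 → z % 2 = 0 → (t + z) % 4 = ρ % 4 →
      (s₂ = 1 ∨ s₂ = -1) → (s₃ = 1 ∨ s₃ = -1) → 0 ≤ t → t ≤ 2 * d → 0 ≤ z → z ≤ 2 * d - 2 →
      0 ≤ t + 2 * s₂ → t + 2 * s₂ ≤ 2 * d → 0 ≤ z + 2 * s₃ → z + 2 * s₃ ≤ 2 * d - 2 →
      G (t + 2 * s₂) (z + 2 * s₃) = G t z) :
    ∃ α, ∀ t z : ℤ, t % 2 = 0 → z % 2 = 0 → (t + z) % 4 = ρ % 4 → 0 ≤ t → t ≤ 2 * d → 0 ≤ z →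
      z ≤ 2 * d - 2 → G t z = α := by
  have bottom : ∀ n : ℕ, ∀ t z : ℤ, z = 2 * n → t % 2 = 0 → (t + z) % 4 = ρ % 4 → 0 ≤ t →
      t ≤ 2 * d → z ≤ 2 * d - 2 →
      ∃ t', t' % 2 = 0 ∧ t' % 4 = ρ % 4 ∧ 0 ≤ t' ∧ t' ≤ 2 * d ∧ G t z = G t' 0 := by
    intro n
    induction n with
    | zero =>
      intro t z hz ht hr h1 h2 _
      obtain rfl : z = 0 := by simpa using hz
      exact ⟨t, ht, by omega, h1, h2, rfl⟩
    | succ n ih =>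
      intro t z hz ht hr h1 h2 h3
      obtain ⟨e, he, he1, he2⟩ : ∃ e : ℤ, (e = 1 ∨ e = -1) ∧ 0 ≤ t + 2 * e ∧
          t + 2 * e ≤ 2 * d := by
        by_cases h0 : t = 0
        · exact ⟨1, by omega⟩
        · exact ⟨-1, by omega⟩
      obtain ⟨t', h⟩ := ih (t + 2 * e) (z + 2 * -1) (by omega) (by omega) (by omega) he1 he2
        (by omega)
      refine ⟨t', h.1, h.2.1, h.2.2.1, h.2.2.2.1, ?_⟩
      rw [← h.2.2.2.2]
      exact (hG t z e (-1) ht (by omega) hr he (Or.inr rfl) h1 h2 (by omega) h3 he1 he2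
        (by omega) (by omega)).symm
  have line : ∀ n : ℕ, ∀ t : ℤ, t = 2 * n → t % 4 = ρ % 4 → t ≤ 2 * d →
      G t 0 = G (ρ % 4) 0 := by
    intro n
    induction n using Nat.strong_induction_on with
    | _ n ih =>
      intro t ht hr h2
      by_cases h4 : t < 4
      · rw [show t = ρ % 4 by omega]
      · rw [← ih (n - 2) (by omega) (t - 4) (by omega) (by omega) (by omega)]
        have e1 := hG (t - 4) 0 1 1 (by omega) (by omega) (by omega) (Or.inl rfl) (Or.inl rfl)
          (by omega) (by omega) (by omega) (by omega) (by omega) (by omega) (by omega) (by omega)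
        have e2 := hG (t - 4 + 2 * 1) (0 + 2 * 1) 1 (-1) (by omega) (by omega) (by omega)
          (Or.inl rfl) (Or.inr rfl)
          (by omega) (by omega) (by omega) (by omega) (by omega) (by omega) (by omega) (by omega)
        rw [← e1, ← e2]
        congr 1; ring
  refine ⟨G (ρ % 4) 0, fun t z ht hz hr h1 h2 h3 h4 => ?_⟩
  obtain ⟨t', h1', h2', h3', h4', h⟩ := bottom (z / 2).toNat t z (by omega) ht hr h1 h2 h4
  rw [h]
  exact line (t' / 2).toNat t' (by omega) h2' h4'

/-- A function on the vertices that is closed on the triangles is the sum of the coboundary of a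
potential and of a multiple of the indicator function of the boundary at the far end. -/
theorem exists_zigzag_potential (hd : 2 ≤ d) (hρ : ρ % 2 = 0) (hW : TriangleClosed d ρ W)
    (h0 : ∀ t z, W 0 t z = 0) (h1 : ∀ t z, W (2 * d) t z = 0) :
    ∃ (f : ℤ → ℤ → ℤ → ZMod 2) (α : ZMod 2), (∀ t z, f 0 t z = 0) ∧
      (∀ a t z : ℤ, 2 * d ≤ a → f a t z = 0) ∧
      (∀ a t z s₂ s₃ : ℤ, a % 2 = 0 → 2 ≤ a → a ≤ 2 * d - 2 → t % 2 = 0 → z % 2 = 0 →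
        (a + t + z) % 4 = (ρ + 2) % 4 →
        (s₂ = 1 ∨ s₂ = -1) → (s₃ = 1 ∨ s₃ = -1) → 1 ≤ t + s₂ → t + s₂ ≤ 2 * d - 1 →
        0 ≤ z + s₃ → z + s₃ ≤ 2 * d - 2 →
        W a (t + s₂) (z + s₃) = f a (t + 2 * s₂) z + f a t (z + 2 * s₃)) ∧
      (∀ a t z s : ℤ, a % 2 = 0 → 0 ≤ a → a ≤ 2 * d - 2 → t % 2 = 0 → z % 2 = 0 →
        (a + 2 + t + z) % 4 = ρ % 4 → 0 ≤ t → t ≤ 2 * d → 0 ≤ z → z ≤ 2 * d - 2 →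
        (s = 1 ∨ s = -1) →
        (1 ≤ t + s → t + s ≤ 2 * d - 1 → W (a + 1) (t + s) z =
          f a (t + 2 * s) z + f (a + 2) t z + if a = 2 * d - 2 then α else 0) ∧
        (2 ≤ t → t ≤ 2 * d - 2 → 0 ≤ z + s → z + s ≤ 2 * d - 2 → W (a + 1) t (z + s) =
          f a t (z + 2 * s) + f (a + 2) t z + if a = 2 * d - 2 then α else 0)) := by
  have hL := layerPotential_zigzag hd hρ hW h0
  -- `W` vanishes on layer `2 * d`, so the potential is constant there. In that layer `t + z` has
  -- residue `ρ - 2 * d` modulo four.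
  obtain ⟨α, hα⟩ := eq_of_diagonal_eq (ρ := ρ - 2 * d) (G := zigzagPotential W d) hd (by
    intro t z s₂ s₃ ht hz hr h2 h3 ht1 ht2 hz1 hz2 ht3 ht4 hz3 hz4
    have h := hL d le_rfl t (z + 2 * s₃) s₂ (-s₃) ht (by omega) (by omega) h2 (by omega)
      (by omega) (by omega) (by omega) (by omega)
    rw [h1, show z + 2 * s₃ + 2 * -s₃ = z by ring] at h
    linear_combination h + zigzagPotential W d (t + 2 * s₂) (z + 2 * s₃) * zmod_two_eq_zero)
  have hf : ∀ k : ℕ, k < d → ∀ t z : ℤ,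
      (if (2 * k : ℤ) < 2 * d then zigzagPotential W (2 * k / 2 : ℤ).toNat t z else 0) =
        zigzagPotential W k t z := by
    intro k hk t z
    rw [if_pos (by omega)]
    congr 1
    omega
  refine ⟨fun a t z => if a < 2 * d then zigzagPotential W (a / 2).toNat t z else 0, α, ?_, ?_,
    ?_, ?_⟩
  · intro t z
    simp [zigzagPotential]
  · intro a t z ha
    exact if_neg (by omega)
  · intro a t z s₂ s₃ ha ha1 ha2 ht hz hr h2 h3 ht1 ht2 hz1 hz2
    obtain ⟨k, rfl⟩ : ∃ k : ℕ, a = 2 * k := ⟨(a / 2).toNat, by omega⟩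
    simp only [hf k (by omega)]
    exact hL k (by omega) t z s₂ s₃ ht hz hr h2 h3 ht1 ht2 hz1 hz2
  · intro a t z s ha ha1 ha2 ht hz hr ht1 ht2 hz1 hz2 hs
    obtain ⟨k, rfl⟩ : ∃ k : ℕ, a = 2 * k := ⟨(a / 2).toNat, by omega⟩
    have hS := stepPotential_zigzag hd hρ hW (by omega) (hL k (by omega)) t z s ht hz hr ht1 ht2
      hz1 hz2 hs
    -- On the last layer `f` is cut off to zero, while the zigzag potential equals `α`; the
    -- correction term makes up the difference.
    have hup : (if (2 * k + 2 : ℤ) < 2 * d then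
        zigzagPotential W ((2 * k + 2 : ℤ) / 2).toNat t z else 0) +
        (if (2 * k : ℤ) = 2 * d - 2 then α else 0) = zigzagPotential W (k + 1) t z := by
      by_cases hk : k + 1 < d
      · have h := hf (k + 1) hk t z
        push_cast at h
        rw [mul_add, mul_one] at h
        rw [h, if_neg (by omega), add_zero]
      · obtain rfl : d = k + 1 := by omega
        rw [if_neg (by push_cast; omega), if_pos (by push_cast; omega), zero_add]
        exact (hα t z ht hz (by push_cast at hr ⊢; omega) ht1 ht2 hz1 hz2).symm
    simp only [hf k (by omega), add_assoc, hup]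
    simpa only [add_assoc] using hS

end Zigzag

/-! ### Potentials for the `g`-code, on the cubic lattice of octahedron centres. -/

section Columns

variable {d : ℕ} {W : ℤ → ℤ → ℤ → ZMod 2}

/-- The potential obtained by summing `W` along vertical lines. -/
def columnPotential (W : ℤ → ℤ → ℤ → ZMod 2) : ℕ → ℤ → ℤ → ZMod 2
  | 0, _, _ => 0
  | k + 1, x, y => columnPotential W k x y + W x y (2 * k)

/-- The plaquettes stacked between two adjacent columns telescope: a horizontal edge equals the sum
of the vertical edges below it in both columns. The vector `(e₁, e₂)` is the direction of that edge.
-/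
theorem columnPotential_step (e₁ e₂ : ℤ) {x y : ℤ}
    (hW : ∀ z : ℤ, z % 2 = 0 → 0 ≤ z → z ≤ 2 * d - 2 →
      W (x + e₁) (y + e₂) z + W (x - e₁) (y - e₂) z + W x y (z + 1) + W x y (z - 1) = 0)
    (h0 : W x y (-1) = 0) : ∀ k : ℕ, k ≤ d → W x y (2 * k - 1) =
      columnPotential W k (x + e₁) (y + e₂) + columnPotential W k (x - e₁) (y - e₂) := by
  intro k
  induction k with
  | zero => intro _; simpa [columnPotential] using h0
  | succ k ih =>
    intro hk
    have h := hW (2 * k) (by omega) (by omega) (by omega)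
    rw [ih (by omega)] at h
    simp only [columnPotential]
    rw [show (2 * ((k + 1 : ℕ) : ℤ) - 1) = 2 * k + 1 by push_cast; ring]
    linear_combination h - (columnPotential W k (x + e₁) (y + e₂) +
      columnPotential W k (x - e₁) (y - e₂) + W (x + e₁) (y + e₂) (2 * k) +
      W (x - e₁) (y - e₂) (2 * k)) * zmod_two_eq_zero

theorem eq_of_step_eq {G : ℤ → ℤ → ZMod 2}
    (h1 : ∀ x y : ℤ, x % 2 = 0 → 2 ≤ x → x ≤ 2 * d - 2 → y % 2 = 1 → 1 ≤ y → y ≤ 2 * d - 1 →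
      G (x + 1) y = G (x - 1) y)
    (h2 : ∀ x y : ℤ, x % 2 = 1 → 1 ≤ x → x ≤ 2 * d - 1 → y % 2 = 0 → 2 ≤ y → y ≤ 2 * d - 2 →
      G x (y + 1) = G x (y - 1)) :
    ∀ x y : ℤ, x % 2 = 1 → 1 ≤ x → x ≤ 2 * d - 1 → y % 2 = 1 → 1 ≤ y → y ≤ 2 * d - 1 →
      G x y = G 1 1 := by
  have hx : ∀ n : ℕ, ∀ x y : ℤ, x = 2 * n + 1 → x ≤ 2 * d - 1 → y % 2 = 1 → 1 ≤ y →
      y ≤ 2 * d - 1 → G x y = G 1 y := by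
    intro n
    induction n with
    | zero => intro x y hx _ _ _ _; rw [show x = 1 by simpa using hx]
    | succ n ih =>
      intro x y hx hx2 hy hy1 hy2
      have h := h1 (x - 1) y (by omega) (by omega) (by omega) hy hy1 hy2
      rw [sub_add_cancel] at h
      rw [h, ih (x - 1 - 1) y (by omega) (by omega) hy hy1 hy2]
  have hy : ∀ n : ℕ, ∀ y : ℤ, y = 2 * n + 1 → y ≤ 2 * d - 1 → G 1 y = G 1 1 := by
    intro n
    induction n with
    | zero => intro y hy _; rw [show y = 1 by simpa using hy]
    | succ n ih =>
      intro y hy hy2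
      have h := h2 1 (y - 1) (by omega) (by omega) (by omega) (by omega) (by omega) (by omega)
      rw [sub_add_cancel] at h
      rw [h, ih (y - 1 - 1) (by omega) (by omega)]
  intro x y hx0 hx1 hx2 hy0 hy1 hy2
  rw [hx (x / 2).toNat x y (by omega) hx2 hy0 hy1 hy2, hy (y / 2).toNat y (by omega) hy2]

/-- A function on the edges of the cubic lattice that is closed on the vertical plaquettes is the
sum of the coboundary of a potential and of a multiple of the indicator function of the top. -/
theorem exists_column_potential
    (h1 : ∀ x y z : ℤ, x % 2 = 0 → 2 ≤ x → x ≤ 2 * d - 2 → y % 2 = 1 → 1 ≤ y → y ≤ 2 * d - 1 →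
      z % 2 = 0 → 0 ≤ z → z ≤ 2 * d - 2 →
      W (x + 1) (y + 0) z + W (x - 1) (y - 0) z + W x y (z + 1) + W x y (z - 1) = 0)
    (h2 : ∀ x y z : ℤ, x % 2 = 1 → 1 ≤ x → x ≤ 2 * d - 1 → y % 2 = 0 → 2 ≤ y → y ≤ 2 * d - 2 →
      z % 2 = 0 → 0 ≤ z → z ≤ 2 * d - 2 →
      W (x + 0) (y + 1) z + W (x - 0) (y - 1) z + W x y (z + 1) + W x y (z - 1) = 0)
    (h0 : ∀ x y, W x y (-1) = 0) (h3 : ∀ x y, W x y (2 * d - 1) = 0) :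
    ∃ (f : ℤ → ℤ → ℤ → ZMod 2) (α : ZMod 2), (∀ x y z, z ≤ -1 → f x y z = 0) ∧
      (∀ x y z : ℤ, 2 * d - 1 ≤ z → f x y z = 0) ∧
      (∀ x y z : ℤ, x % 2 = 0 → 2 ≤ x → x ≤ 2 * d - 2 → y % 2 = 1 → 1 ≤ y → y ≤ 2 * d - 1 →
        z % 2 = 1 → 1 ≤ z → z ≤ 2 * d - 3 → W x y z = f (x + 1) y z + f (x - 1) y z) ∧
      (∀ x y z : ℤ, x % 2 = 1 → 1 ≤ x → x ≤ 2 * d - 1 → y % 2 = 0 → 2 ≤ y → y ≤ 2 * d - 2 →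
        z % 2 = 1 → 1 ≤ z → z ≤ 2 * d - 3 → W x y z = f x (y + 1) z + f x (y - 1) z) ∧
      (∀ x y z : ℤ, x % 2 = 1 → 1 ≤ x → x ≤ 2 * d - 1 → y % 2 = 1 → 1 ≤ y → y ≤ 2 * d - 1 →
        z % 2 = 0 → 0 ≤ z → z ≤ 2 * d - 2 → W x y z =
          f x y (z - 1) + f x y (z + 1) + if z = 2 * d - 2 then α else 0) := by
  have hx : ∀ k : ℕ, k ≤ d → ∀ x y : ℤ, x % 2 = 0 → 2 ≤ x → x ≤ 2 * d - 2 → y % 2 = 1 →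
      1 ≤ y → y ≤ 2 * d - 1 →
      W x y (2 * k - 1) = columnPotential W k (x + 1) y + columnPotential W k (x - 1) y := by
    intro k hk x y hx hx1 hx2 hy hy1 hy2
    have h := columnPotential_step (W := W) 1 0
      (fun z hz hz1 hz2 => h1 x y z hx hx1 hx2 hy hy1 hy2 hz hz1 hz2) (h0 x y) k hk
    simpa using h
  have hy : ∀ k : ℕ, k ≤ d → ∀ x y : ℤ, x % 2 = 1 → 1 ≤ x → x ≤ 2 * d - 1 → y % 2 = 0 →
      2 ≤ y → y ≤ 2 * d - 2 →
      W x y (2 * k - 1) = columnPotential W k x (y + 1) + columnPotential W k x (y - 1) := by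
    intro k hk x y hx hx1 hx2 hy hy1 hy2
    have h := columnPotential_step (W := W) 0 1
      (fun z hz hz1 hz2 => h2 x y z hx hx1 hx2 hy hy1 hy2 hz hz1 hz2) (h0 x y) k hk
    simpa using h
  -- Above the top `W` vanishes, so the total sums of adjacent columns agree; their common value is
  -- the coefficient of the top boundary.
  have hα := eq_of_step_eq (d := d) (G := columnPotential W d)
    (fun x y a1 a2 a3 a4 a5 a6 => by
      have h := hx d le_rfl x y a1 a2 a3 a4 a5 a6
      rw [h3] at h
      linear_combination h + columnPotential W d (x + 1) y * zmod_two_eq_zero)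
    (fun x y a1 a2 a3 a4 a5 a6 => by
      have h := hy d le_rfl x y a1 a2 a3 a4 a5 a6
      rw [h3] at h
      linear_combination h + columnPotential W d x (y + 1) * zmod_two_eq_zero)
  have hf : ∀ k : ℕ, k < d → ∀ x y : ℤ,
      (if (2 * k - 1 : ℤ) < 2 * d - 1 then
        columnPotential W ((2 * k - 1 + 1 : ℤ) / 2).toNat x y else 0) =
        columnPotential W k x y := by
    intro k hk x y
    rw [if_pos (by omega)]
    congr 1
    omega
  refine ⟨fun x y z => if z < 2 * d - 1 then columnPotential W ((z + 1) / 2).toNat x y else 0,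
    columnPotential W d 1 1, ?_, ?_, ?_, ?_, ?_⟩
  · intro x y z hz
    have h : ((z + 1) / 2).toNat = 0 := by omega
    simp [h, columnPotential]
  · intro x y z hz
    exact if_neg (by omega)
  · intro x y z a1 a2 a3 a4 a5 a6 hz hz1 hz2
    obtain ⟨k, rfl⟩ : ∃ k : ℕ, z = 2 * k - 1 := ⟨((z + 1) / 2).toNat, by omega⟩
    simp only [hf k (by omega)]
    exact hx k (by omega) x y a1 a2 a3 a4 a5 a6
  · intro x y z a1 a2 a3 a4 a5 a6 hz hz1 hz2
    obtain ⟨k, rfl⟩ : ∃ k : ℕ, z = 2 * k - 1 := ⟨((z + 1) / 2).toNat, by omega⟩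
    simp only [hf k (by omega)]
    exact hy k (by omega) x y a1 a2 a3 a4 a5 a6
  · intro x y z a1 a2 a3 a4 a5 a6 hz hz1 hz2
    obtain ⟨k, rfl⟩ : ∃ k : ℕ, z = 2 * k := ⟨(z / 2).toNat, by omega⟩
    have hup : (if (2 * k + 1 : ℤ) < 2 * d - 1 then
        columnPotential W ((2 * k + 1 + 1 : ℤ) / 2).toNat x y else 0) +
        (if (2 * k : ℤ) = 2 * d - 2 then columnPotential W d 1 1 else 0) =
        columnPotential W (k + 1) x y := by
      by_cases hk : k + 1 < d
      · rw [if_pos (by omega), if_neg (by omega), add_zero]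
        congr 1
        omega
      · obtain rfl : d = k + 1 := by omega
        rw [if_neg (by push_cast; omega), if_pos (by push_cast; omega), zero_add]
        exact (hα x y a1 a2 a3 a4 a5 a6).symm
    simp only [hf k (by omega)]
    rw [add_assoc (columnPotential W k x y), hup]
    simp only [columnPotential]
    linear_combination - columnPotential W k x y * zmod_two_eq_zero

end Columns

/-! ### Closed strings lie in the `X` span up to a multiple of a boundary. -/

/-- The extension by zero of a function on the vertices to all points. -/
noncomputable def extend {d : ℕ} (w : Vertex d → ZMod 2) (p : Pt) : ZMod 2 :=
  if h : p ∈ vertexSet d then w ⟨p, h⟩ else 0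

theorem extend_of_mem {d : ℕ} (w : Vertex d → ZMod 2) {p : Pt} (h : p ∈ vertexSet d) :
    extend w p = w ⟨p, h⟩ := dif_pos h

theorem extend_of_notMem {d : ℕ} (w : Vertex d → ZMod 2) {p : Pt} (h : p ∉ vertexSet d) :
    extend w p = 0 := dif_neg h

/-- Extension by zero lets a truncated face be summed as if it were complete. -/
theorem sum_eq_sum_extend {d : ℕ} (w : Vertex d → ZMod 2) (s : Finset (Vertex d))
    (S : Finset Pt) (h : ∀ v, v ∈ s ↔ v.1 ∈ S) : ∑ v ∈ s, w v = ∑ p ∈ S, extend w p := by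
  have h1 : ∑ v ∈ s, w v = ∑ p ∈ s.map (Function.Embedding.subtype _), extend w p := by
    rw [Finset.sum_map]
    exact Finset.sum_congr rfl fun v _ => (extend_of_mem w v.2).symm
  rw [h1]
  apply Finset.sum_subset
  · intro p hp
    obtain ⟨v, hv, rfl⟩ := Finset.mem_map.1 hp
    exact (h v).1 hv
  · intro p hp hps
    apply extend_of_notMem
    intro hm
    exact hps (Finset.mem_map.2 ⟨⟨p, hm⟩, (h ⟨p, hm⟩).2 hp, rfl⟩)

/-- A function is closed for the code `c` if it is orthogonal to all `Z` generators. -/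
def Closed (d : ℕ) (c : Colour) (w : Vertex d → ZMod 2) : Prop :=
  ∀ s ∈ zGenerators d c, ∑ v ∈ s, w v = 0

theorem nearSet_mem_xSpan {d : ℕ} (hd : 2 ≤ d) {c : Colour} {q : Pt} (hv : ValidCentre d c q)
    (hq : IsCentre c q) : indicator (nearSet d q) ∈ xSpan d c :=
  Submodule.subset_span ⟨_, (mem_xGenerators hd).2 ⟨q, hv, hq, rfl⟩, rfl⟩

-- The point sum `∑ f p • indicator (nearSet d p)` takes at a vertex the values of `f` at the two
-- centres near it, so a coboundary is a combination of `X` generators.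
open Classical in
theorem mem_xSpan_of_potential {d : ℕ} (hd : 2 ≤ d) {c : Colour} {w : Vertex d → ZMod 2}
    (f : Pt → ZMod 2) (hf : ∀ p, ¬ ValidCentre d c p → f p = 0)
    (h : ∀ v : Vertex d, ∃ p₁ p₂ : Pt, p₁ ≠ p₂ ∧
      (∀ p, (IsCentre c p ∧ Near v.1 p) ↔ p = p₁ ∨ p = p₂) ∧ w v = f p₁ + f p₂) :
    w ∈ xSpan d c := by
  let S : Finset Pt := (Finset.Icc (-1 : ℤ) (2 * d) ×ˢ
    (Finset.Icc (-1 : ℤ) (2 * d) ×ˢ Finset.Icc (-1 : ℤ) (2 * d))).filter (IsCentre c)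
  have hw : w = ∑ p ∈ S, f p • indicator (nearSet d p) := by
    funext v
    obtain ⟨p₁, p₂, hne, hp, hv⟩ := h v
    have hS : S.filter (fun p => Near v.1 p) = {p₁, p₂} := by
      ext p
      have hm := v.2
      rw [mem_vertexSet] at hm
      simp only [S, Finset.mem_filter, Finset.mem_product, Finset.mem_Icc, Finset.mem_insert,
        Finset.mem_singleton, ← hp]
      constructor
      · exact fun h => ⟨h.1.2, h.2⟩
      · rintro ⟨hc, hn⟩
        refine ⟨⟨?_, hc⟩, hn⟩
        unfold Near at hn
        omega
    rw [Finset.sum_apply, hv, ← Finset.sum_pair (f := f) hne, ← hS, Finset.sum_filter]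
    refine Finset.sum_congr rfl fun p _ => ?_
    simp [indicator, mem_nearSet]
  rw [hw]
  refine Submodule.sum_mem _ fun p hp => ?_
  by_cases hv : ValidCentre d c p
  · exact Submodule.smul_mem _ _ (nearSet_mem_xSpan hd hv (Finset.mem_filter.1 hp).2)
  · rw [hf p hv, zero_smul]
    exact Submodule.zero_mem _

theorem near_and_near_iff {p q : Pt} {s₁ s₂ s₃ : ℤ} (hp : IsLatticePoint p) (h1 : q.1 % 2 = 0)
    (h2 : q.2.1 % 2 = 0) (h3 : q.2.2 % 2 = 0) (hs₁ : s₁ = 1 ∨ s₁ = -1) (hs₂ : s₂ = 1 ∨ s₂ = -1)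
    (hs₃ : s₃ = 1 ∨ s₃ = -1) :
    Near p q ∧ Near p (q.1 + s₁, q.2.1 + s₂, q.2.2 + s₃) ↔
      p = (q.1, q.2.1 + s₂, q.2.2 + s₃) ∨ p = (q.1 + s₁, q.2.1, q.2.2 + s₃) ∨
        p = (q.1 + s₁, q.2.1 + s₂, q.2.2) := by
  rw [isLatticePoint_iff] at hp
  obtain ⟨x, y, z⟩ := p
  simp only [Near, Prod.mk.injEq] at hp ⊢
  constructor
  · intro h
    rcases hp with hp | hp | hp
    · exact Or.inr (Or.inr ⟨by omega, by omega, by omega⟩)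
    · exact Or.inr (Or.inl ⟨by omega, by omega, by omega⟩)
    · exact Or.inl ⟨by omega, by omega, by omega⟩
  · rintro (⟨rfl, rfl, rfl⟩ | ⟨rfl, rfl, rfl⟩ | ⟨rfl, rfl, rfl⟩) <;> omega

/-- Triangles around a `b`-centre between the two `r`-boundaries are `bg`-faces. Those around the
layers `a = 0` and `a = 2 * d` keep two vertices and are exactly the weight-two generators. Here `ρ
= 2` is the residue of `r`-centres, and layers are counted along the first axis. -/
theorem triangleClosed_r {d : ℕ} {w : Vertex d → ZMod 2} (hw : Closed d .r w) :
    TriangleClosed d 2 (fun a t z => extend w (a, t, z)) := by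
  intro a t z s₁ s₂ s₃ ha ht hz hr ha1 ha2 ht1 ht2 hz1 hz2 h1 h2 h3 h1a h1b h3a h3b
  have hb : IsCentre .b (a, t, z) := by rw [isCentre_b]; simp only; omega
  have hg : IsCentre .g (a + s₁, t + s₂, z + s₃) := by rw [isCentre_g]; simp only; omega
  have hmem : ∀ v : Vertex d, v ∈ nearSet d (a, t, z) ∩ nearSet d (a + s₁, t + s₂, z + s₃) ↔
      v.1 ∈ ({(a, t + s₂, z + s₃), (a + s₁, t, z + s₃), (a + s₁, t + s₂, z)} : Finset Pt) := by
    intro v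
    simp only [Finset.mem_inter, mem_nearSet, Finset.mem_insert, Finset.mem_singleton]
    exact near_and_near_iff (q := (a, t, z)) (isLatticePoint_of_vertex v) ha ht hz h1 h2 h3
  have hgen : nearSet d (a, t, z) ∩ nearSet d (a + s₁, t + s₂, z + s₃) ∈ zGenerators d .r := by
    by_cases hin : 2 ≤ a ∧ a ≤ 2 * d - 2
    · refine Or.inl ⟨_, _, hb, hg, Or.inl ?_, by rw [cell_eq hb, cell_eq hg], ?_⟩
      · simp only [InBox]; omega
      · refine three_le_card (a := ⟨(a, t + s₂, z + s₃), ?_⟩) (b := ⟨(a + s₁, t, z + s₃), ?_⟩)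
          (c := ⟨(a + s₁, t + s₂, z), ?_⟩) ?_ ?_ ?_ ?_ ?_ ?_
        all_goals
          simp only [mem_vertexSet, hmem, ne_eq, Subtype.mk.injEq, Prod.mk.injEq,
            Finset.mem_insert, Finset.mem_singleton, true_and, and_true, true_or, or_true]
        all_goals omega
    -- The `b`-centre lies outside the box; its mirror image in the boundary is the `r`-cell whose
    -- boundary face carries the edge.
    · obtain ⟨side, hs⟩ : ∃ side : Bool, a + s₁ = if side then 2 * (d : ℤ) - 1 else 1 := by
        by_cases h0 : a = 0
        · exact ⟨false, by simp; omega⟩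
        · exact ⟨true, by simp; omega⟩
      have hq : IsCentre .r (a + 2 * s₁, t, z) := by rw [isCentre_r]; simp only; omega
      refine Or.inr ⟨_, ⟨(a + 2 * s₁, t, z), side, ?_, hq, rfl, ?_⟩, _, _, hb, hg, ?_, ?_⟩
      · simp only [InBox]; omega
      · rw [cell_eq hq]
        refine three_le_card (a := ⟨(a + s₁, t + 1, z), ?_⟩) (b := ⟨(a + s₁, t - 1, z), ?_⟩)
          (c := ⟨(a + s₁, t, z + s₃), ?_⟩) ?_ ?_ ?_ ?_ ?_ ?_
        all_goals
          simp only [mem_vertexSet, Finset.mem_inter, mem_nearSet, mem_boundary_r, Near, ne_eq,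
            Subtype.mk.injEq, Prod.mk.injEq, ← hs, true_and, and_true]
        all_goals omega
      · rw [cell_eq hb, cell_eq hg, cell_eq hq]
        ext ⟨⟨x, y, u⟩, hv⟩
        rw [mem_vertexSet] at hv
        simp only [Finset.mem_inter, mem_nearSet, mem_boundary_r, Near, ← hs] at hv ⊢
        omega
      · rw [Finset.card_eq_two]
        refine ⟨⟨(a + s₁, t, z + s₃), ?_⟩, ⟨(a + s₁, t + s₂, z), ?_⟩, ?_, ?_⟩
        · simp only [mem_vertexSet]; omega
        · simp only [mem_vertexSet]; omega
        · simp only [ne_eq, Subtype.mk.injEq, Prod.mk.injEq]; omega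
        · ext v
          have hv := v.2
          rw [mem_vertexSet] at hv
          rw [hmem]
          simp only [Finset.mem_insert, Finset.mem_singleton, Subtype.ext_iff, Prod.ext_iff]
          omega
  have h := hw _ hgen
  rw [sum_eq_sum_extend w _ _ hmem, Finset.sum_insert, Finset.sum_pair, ← add_assoc] at h
  · exact h
  · simp only [ne_eq, Prod.mk.injEq]; omega
  · simp only [Finset.mem_insert, Finset.mem_singleton, Prod.mk.injEq]; omega

/-- The first two axes trade roles: layers are counted along the second axis, and the residue is
`0`. -/
theorem triangleClosed_b {d : ℕ} {w : Vertex d → ZMod 2} (hw : Closed d .b w) :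
    TriangleClosed d 0 (fun a t z => extend w (t, a, z)) := by
  intro a t z s₁ s₂ s₃ ha ht hz hr ha1 ha2 ht1 ht2 hz1 hz2 h1 h2 h3 h1a h1b h3a h3b
  have hb : IsCentre .r (t, a, z) := by rw [isCentre_r]; simp only; omega
  have hg : IsCentre .g (t + s₂, a + s₁, z + s₃) := by rw [isCentre_g]; simp only; omega
  have hmem : ∀ v : Vertex d, v ∈ nearSet d (t, a, z) ∩ nearSet d (t + s₂, a + s₁, z + s₃) ↔
      v.1 ∈ ({(t + s₂, a, z + s₃), (t, a + s₁, z + s₃), (t + s₂, a + s₁, z)} : Finset Pt) := by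
    intro v
    simp only [Finset.mem_inter, mem_nearSet, Finset.mem_insert, Finset.mem_singleton]
    rw [near_and_near_iff (q := (t, a, z)) (isLatticePoint_of_vertex v) ht ha hz h2 h1 h3]
    simp only
    tauto
  have hgen : nearSet d (t, a, z) ∩ nearSet d (t + s₂, a + s₁, z + s₃) ∈ zGenerators d .b := by
    by_cases hin : 2 ≤ a ∧ a ≤ 2 * d - 2
    · refine Or.inl ⟨_, _, hb, hg, Or.inl ?_, by rw [cell_eq hb, cell_eq hg], ?_⟩
      · simp only [InBox]; omega
      · refine three_le_card (a := ⟨(t + s₂, a, z + s₃), ?_⟩) (b := ⟨(t, a + s₁, z + s₃), ?_⟩)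
          (c := ⟨(t + s₂, a + s₁, z), ?_⟩) ?_ ?_ ?_ ?_ ?_ ?_
        all_goals
          simp only [mem_vertexSet, hmem, ne_eq, Subtype.mk.injEq, Prod.mk.injEq,
            Finset.mem_insert, Finset.mem_singleton, true_and, and_true, true_or, or_true]
        all_goals omega
    · obtain ⟨side, hs⟩ : ∃ side : Bool, a + s₁ = if side then 2 * (d : ℤ) - 1 else 1 := by
        by_cases h0 : a = 0
        · exact ⟨false, by simp; omega⟩
        · exact ⟨true, by simp; omega⟩
      have hq : IsCentre .b (t, a + 2 * s₁, z) := by rw [isCentre_b]; simp only; omega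
      refine Or.inr ⟨_, ⟨(t, a + 2 * s₁, z), side, ?_, hq, rfl, ?_⟩, _, _, hb, hg, ?_, ?_⟩
      · simp only [InBox]; omega
      · rw [cell_eq hq]
        refine three_le_card (a := ⟨(t + 1, a + s₁, z), ?_⟩) (b := ⟨(t - 1, a + s₁, z), ?_⟩)
          (c := ⟨(t, a + s₁, z + s₃), ?_⟩) ?_ ?_ ?_ ?_ ?_ ?_
        all_goals
          simp only [mem_vertexSet, Finset.mem_inter, mem_nearSet, mem_boundary_b, Near, ne_eq,
            Subtype.mk.injEq, Prod.mk.injEq, ← hs, true_and, and_true]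
        all_goals omega
      · rw [cell_eq hb, cell_eq hg, cell_eq hq]
        ext ⟨⟨x, y, u⟩, hv⟩
        rw [mem_vertexSet] at hv
        simp only [Finset.mem_inter, mem_nearSet, mem_boundary_b, Near, ← hs] at hv ⊢
        omega
      · rw [Finset.card_eq_two]
        refine ⟨⟨(t, a + s₁, z + s₃), ?_⟩, ⟨(t + s₂, a + s₁, z), ?_⟩, ?_, ?_⟩
        · simp only [mem_vertexSet]; omega
        · simp only [mem_vertexSet]; omega
        · simp only [ne_eq, Subtype.mk.injEq, Prod.mk.injEq]; omega
        · ext v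
          have hv := v.2
          rw [mem_vertexSet] at hv
          rw [hmem]
          simp only [Finset.mem_insert, Finset.mem_singleton, Subtype.ext_iff, Prod.ext_iff]
          omega
  have h := hw _ hgen
  rw [sum_eq_sum_extend w _ _ hmem, Finset.sum_insert, Finset.sum_pair, ← add_assoc] at h
  · exact h
  · simp only [ne_eq, Prod.mk.injEq]; omega
  · simp only [Finset.mem_insert, Finset.mem_singleton, Prod.mk.injEq]; omega

/-- Covers both colourings of a pair of neighbouring cuboctahedra, so the plaquettes below need not
know which of the two is `r`. -/
theorem nearSet_inter_mem_zGenerators_g {d : ℕ} {p q : Pt}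
    (hp : p.1 % 2 = 0 ∧ p.2.1 % 2 = 0 ∧ p.2.2 % 2 = 0)
    (hq : q.1 % 2 = 0 ∧ q.2.1 % 2 = 0 ∧ q.2.2 % 2 = 0)
    (h : (p.1 + p.2.1 + p.2.2) % 4 ≠ (q.1 + q.2.1 + q.2.2) % 4) (hb : InBox d p ∨ InBox d q)
    (h3 : 3 ≤ (nearSet d p ∩ nearSet d q).card) :
    nearSet d p ∩ nearSet d q ∈ zGenerators d .g := by
  by_cases hr : (p.1 + p.2.1 + p.2.2) % 4 = 2
  · have hp' : IsCentre .r p := by rw [isCentre_r]; omega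
    have hq' : IsCentre .b q := by rw [isCentre_b]; omega
    exact ⟨p, q, hp', hq', hb, by rw [cell_eq hp', cell_eq hq'], h3⟩
  · have hp' : IsCentre .b p := by rw [isCentre_b]; omega
    have hq' : IsCentre .r q := by rw [isCentre_r]; omega
    exact ⟨q, p, hq', hp', hb.symm, by rw [cell_eq hp', cell_eq hq', Finset.inter_comm], h3⟩

theorem plaquette_x_closed {d : ℕ} {w : Vertex d → ZMod 2} (hw : Closed d .g w)
    (hd : 2 ≤ d) (x y z : ℤ) (hx : x % 2 = 0) (hx1 : 2 ≤ x) (hx2 : x ≤ 2 * d - 2)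
    (hy : y % 2 = 1) (hy1 : 1 ≤ y) (hy2 : y ≤ 2 * d - 1) (hz : z % 2 = 0) (hz1 : 0 ≤ z)
    (hz2 : z ≤ 2 * d - 2) :
    extend w (x + 1, y + 0, z) + extend w (x - 1, y - 0, z) + extend w (x, y, z + 1) +
      extend w (x, y, z - 1) = 0 := by
  have hmem : ∀ v : Vertex d, v ∈ nearSet d (x, y - 1, z) ∩ nearSet d (x, y + 1, z) ↔
      v.1 ∈ ({(x + 1, y, z), (x - 1, y, z), (x, y, z + 1), (x, y, z - 1)} : Finset Pt) := by
    rintro ⟨⟨x', y', z'⟩, hv⟩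
    rw [mem_vertexSet] at hv
    simp only [Finset.mem_inter, mem_nearSet, Near, Finset.mem_insert, Finset.mem_singleton,
      Prod.mk.injEq] at hv ⊢
    omega
  obtain ⟨e, he, he1, he2⟩ : ∃ e : ℤ, (e = 1 ∨ e = -1) ∧ 0 ≤ z + e ∧ z + e ≤ 2 * d - 2 := by
    by_cases h0 : z = 0
    · exact ⟨1, by omega⟩
    · exact ⟨-1, by omega⟩
  have h := hw _ (nearSet_inter_mem_zGenerators_g (d := d) (p := (x, y - 1, z))
    (q := (x, y + 1, z)) (by simp only; omega) (by simp only; omega) (by simp only; omega)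
    (by simp only [InBox]; omega) (by
      refine three_le_card (a := ⟨(x + 1, y, z), ?_⟩) (b := ⟨(x - 1, y, z), ?_⟩)
          (c := ⟨(x, y, z + e), ?_⟩) ?_ ?_ ?_ ?_ ?_ ?_
      all_goals
        simp only [mem_vertexSet, hmem, ne_eq, Subtype.mk.injEq, Prod.mk.injEq,
          Finset.mem_insert, Finset.mem_singleton, true_and, and_true, true_or, or_true]
      all_goals omega))
  rw [sum_eq_sum_extend w _ _ hmem, Finset.sum_insert, Finset.sum_insert, Finset.sum_pair,
    ← add_assoc, ← add_assoc] at h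
  · simpa using h
  all_goals simp only [Finset.mem_insert, Finset.mem_singleton, ne_eq, Prod.mk.injEq]; omega

theorem plaquette_y_closed {d : ℕ} {w : Vertex d → ZMod 2} (hw : Closed d .g w)
    (hd : 2 ≤ d) (x y z : ℤ) (hx : x % 2 = 1) (hx1 : 1 ≤ x) (hx2 : x ≤ 2 * d - 1)
    (hy : y % 2 = 0) (hy1 : 2 ≤ y) (hy2 : y ≤ 2 * d - 2) (hz : z % 2 = 0) (hz1 : 0 ≤ z)
    (hz2 : z ≤ 2 * d - 2) :
    extend w (x + 0, y + 1, z) + extend w (x - 0, y - 1, z) + extend w (x, y, z + 1) +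
      extend w (x, y, z - 1) = 0 := by
  have hmem : ∀ v : Vertex d, v ∈ nearSet d (x - 1, y, z) ∩ nearSet d (x + 1, y, z) ↔
      v.1 ∈ ({(x, y + 1, z), (x, y - 1, z), (x, y, z + 1), (x, y, z - 1)} : Finset Pt) := by
    rintro ⟨⟨x', y', z'⟩, hv⟩
    rw [mem_vertexSet] at hv
    simp only [Finset.mem_inter, mem_nearSet, Near, Finset.mem_insert, Finset.mem_singleton,
      Prod.mk.injEq] at hv ⊢
    omega
  obtain ⟨e, he, he1, he2⟩ : ∃ e : ℤ, (e = 1 ∨ e = -1) ∧ 0 ≤ z + e ∧ z + e ≤ 2 * d - 2 := by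
    by_cases h0 : z = 0
    · exact ⟨1, by omega⟩
    · exact ⟨-1, by omega⟩
  have h := hw _ (nearSet_inter_mem_zGenerators_g (d := d) (p := (x - 1, y, z))
    (q := (x + 1, y, z)) (by simp only; omega) (by simp only; omega) (by simp only; omega)
    (by simp only [InBox]; omega) (by
      refine three_le_card (a := ⟨(x, y + 1, z), ?_⟩) (b := ⟨(x, y - 1, z), ?_⟩)
          (c := ⟨(x, y, z + e), ?_⟩) ?_ ?_ ?_ ?_ ?_ ?_
      all_goals
        simp only [mem_vertexSet, hmem, ne_eq, Subtype.mk.injEq, Prod.mk.injEq,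
          Finset.mem_insert, Finset.mem_singleton, true_and, and_true, true_or, or_true]
      all_goals omega))
  rw [sum_eq_sum_extend w _ _ hmem, Finset.sum_insert, Finset.sum_insert, Finset.sum_pair,
    ← add_assoc, ← add_assoc] at h
  · simpa using h
  all_goals simp only [Finset.mem_insert, Finset.mem_singleton, ne_eq, Prod.mk.injEq]; omega

theorem closed_r_complete {d : ℕ} (hd : 2 ≤ d) {w : Vertex d → ZMod 2} (hw : Closed d .r w) :
    ∃ α : ZMod 2, w + α • indicator (boundary d .r true) ∈ xSpan d .r := by
  obtain ⟨f, α, hf0, hf1, hlayer, hstep⟩ := exists_zigzag_potential hd (by norm_num)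
    (triangleClosed_r hw)
    (fun t z => extend_of_notMem w (by rw [mem_vertexSet]; simp only; omega))
    (fun t z => extend_of_notMem w (by rw [mem_vertexSet]; simp only; omega))
  classical
  let F : Pt → ZMod 2 := fun p => if ValidCentre d .r p then f p.1 p.2.1 p.2.2 else 0
  -- `f` already vanishes on the two layers outside the box, so the restriction to valid centres
  -- loses nothing.
  have hF : ∀ a t z : ℤ, a % 2 = 0 → 0 ≤ a → 0 ≤ t → t ≤ 2 * d → 0 ≤ z → z ≤ 2 * d - 2 →
      F (a, t, z) = f a t z := by
    intro a t z ha ha0 ht1 ht2 hz1 hz2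
    by_cases h : ValidCentre d .r (a, t, z)
    · exact if_pos h
    · rw [show F (a, t, z) = 0 from if_neg h]
      simp only [ValidCentre] at h
      by_cases h0 : a = 0
      · rw [h0, hf0]
      · rw [hf1 a t z (by omega)]
  refine ⟨α, mem_xSpan_of_potential hd F (fun p hp => if_neg hp) ?_⟩
  rintro ⟨⟨x, y, z⟩, hv⟩
  have hm := hv
  rw [mem_vertexSet] at hm
  simp only at hm
  have hwv : w ⟨(x, y, z), hv⟩ = extend w (x, y, z) := (extend_of_mem w hv).symm
  have hind : (α • indicator (boundary d .r true)) ⟨(x, y, z), hv⟩ =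
      if x = 2 * d - 1 then α else 0 := by
    simp [indicator, mem_boundary_r]
  rw [Pi.add_apply, hwv, hind]
  rcases hm.2 with hp | hp | hp
  -- The four even corners around this vertex alternate in colour; `s` selects the diagonal whose
  -- ends are `r`-centres.
  · obtain ⟨s, hs, hr⟩ : ∃ s : ℤ, (s = 1 ∨ s = -1) ∧ (x + 1 + (y - s) + z) % 4 = 2 := by
      by_cases h : (x + 1 + (y - 1) + z) % 4 = 2
      · exact ⟨1, by omega⟩
      · exact ⟨-1, by omega⟩
    have h := (hstep (x - 1) (y - s) z s (by omega) (by omega) (by omega) (by omega) (by omega)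
      (by omega) (by omega) (by omega) (by omega) (by omega) hs).1 (by omega) (by omega)
    rw [show x - 1 + 1 = x by ring, show y - s + s = y by ring,
      show y - s + 2 * s = y + s by ring, show x - 1 + 2 = x + 1 by ring] at h
    refine ⟨(x - 1, y + s, z), (x + 1, y - s, z), ?_, ?_, ?_⟩
    · simp only [ne_eq, Prod.mk.injEq]; omega
    · rintro ⟨x', y', z'⟩
      simp only [isCentre_r, Near, Prod.mk.injEq]
      rcases hs with rfl | rfl <;> constructor <;> intro h <;> omega
    · rw [hF _ _ _ (by omega) (by omega) (by omega) (by omega) (by omega) (by omega),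
        hF _ _ _ (by omega) (by omega) (by omega) (by omega) (by omega) (by omega), h,
        if_congr (show x - 1 = 2 * (d : ℤ) - 2 ↔ x = 2 * d - 1 by omega) rfl rfl, add_assoc,
        CharTwo.add_self_eq_zero, add_zero]
  · obtain ⟨s, hs, hr⟩ : ∃ s : ℤ, (s = 1 ∨ s = -1) ∧ (x + 1 + y + (z - s)) % 4 = 2 := by
      by_cases h : (x + 1 + y + (z - 1)) % 4 = 2
      · exact ⟨1, by omega⟩
      · exact ⟨-1, by omega⟩
    have h := (hstep (x - 1) y (z - s) s (by omega) (by omega) (by omega) (by omega) (by omega)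
      (by omega) (by omega) (by omega) (by omega) (by omega) hs).2 (by omega) (by omega)
      (by omega) (by omega)
    rw [show x - 1 + 1 = x by ring, show z - s + s = z by ring,
      show z - s + 2 * s = z + s by ring, show x - 1 + 2 = x + 1 by ring] at h
    refine ⟨(x - 1, y, z + s), (x + 1, y, z - s), ?_, ?_, ?_⟩
    · simp only [ne_eq, Prod.mk.injEq]; omega
    · rintro ⟨x', y', z'⟩
      simp only [isCentre_r, Near, Prod.mk.injEq]
      rcases hs with rfl | rfl <;> constructor <;> intro h <;> omega
    · rw [hF _ _ _ (by omega) (by omega) (by omega) (by omega) (by omega) (by omega),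
        hF _ _ _ (by omega) (by omega) (by omega) (by omega) (by omega) (by omega), h,
        if_congr (show x - 1 = 2 * (d : ℤ) - 2 ↔ x = 2 * d - 1 by omega) rfl rfl, add_assoc,
        CharTwo.add_self_eq_zero, add_zero]
  -- For even `x` both `r`-centres lie in the layer `x`, so the layer equation applies instead of
  -- the step equation.
  · obtain ⟨s, hs, hr⟩ : ∃ s : ℤ, (s = 1 ∨ s = -1) ∧ (x + (y - 1) + (z - s)) % 4 = 0 := by
      by_cases h : (x + (y - 1) + (z - 1)) % 4 = 0
      · exact ⟨1, by omega⟩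
      · exact ⟨-1, by omega⟩
    have h := hlayer x (y - 1) (z - s) 1 s (by omega) (by omega) (by omega) (by omega) (by omega)
      (by omega) (Or.inl rfl) hs (by omega) (by omega) (by omega) (by omega)
    rw [show y - 1 + 1 = y by ring, show z - s + s = z by ring,
      show z - s + 2 * s = z + s by ring, show y - 1 + 2 * 1 = y + 1 by ring] at h
    refine ⟨(x, y + 1, z - s), (x, y - 1, z + s), ?_, ?_, ?_⟩
    · simp only [ne_eq, Prod.mk.injEq]; omega
    · rintro ⟨x', y', z'⟩
      simp only [isCentre_r, Near, Prod.mk.injEq]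
      rcases hs with rfl | rfl <;> constructor <;> intro h <;> omega
    · rw [hF _ _ _ (by omega) (by omega) (by omega) (by omega) (by omega) (by omega),
        hF _ _ _ (by omega) (by omega) (by omega) (by omega) (by omega) (by omega), h,
        if_neg (by omega), add_zero]

theorem closed_b_complete {d : ℕ} (hd : 2 ≤ d) {w : Vertex d → ZMod 2} (hw : Closed d .b w) :
    ∃ α : ZMod 2, w + α • indicator (boundary d .b true) ∈ xSpan d .b := by
  obtain ⟨f, α, hf0, hf1, hlayer, hstep⟩ := exists_zigzag_potential hd (by norm_num)
    (triangleClosed_b hw)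
    (fun t z => extend_of_notMem w (by rw [mem_vertexSet]; simp only; omega))
    (fun t z => extend_of_notMem w (by rw [mem_vertexSet]; simp only; omega))
  classical
  let F : Pt → ZMod 2 := fun p => if ValidCentre d .b p then f p.2.1 p.1 p.2.2 else 0
  have hF : ∀ a t z : ℤ, a % 2 = 0 → 0 ≤ a → 0 ≤ t → t ≤ 2 * d → 0 ≤ z → z ≤ 2 * d - 2 →
      F (t, a, z) = f a t z := by
    intro a t z ha ha0 ht1 ht2 hz1 hz2
    by_cases h : ValidCentre d .b (t, a, z)
    · exact if_pos h
    · rw [show F (t, a, z) = 0 from if_neg h]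
      simp only [ValidCentre] at h
      by_cases h0 : a = 0
      · rw [h0, hf0]
      · rw [hf1 a t z (by omega)]
  refine ⟨α, mem_xSpan_of_potential hd F (fun p hp => if_neg hp) ?_⟩
  rintro ⟨⟨y, x, z⟩, hv⟩
  have hm := hv
  rw [mem_vertexSet] at hm
  simp only at hm
  have hwv : w ⟨(y, x, z), hv⟩ = extend w (y, x, z) := (extend_of_mem w hv).symm
  have hind : (α • indicator (boundary d .b true)) ⟨(y, x, z), hv⟩ =
      if x = 2 * d - 1 then α else 0 := by
    simp [indicator, mem_boundary_b]
  rw [Pi.add_apply, hwv, hind]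
  rcases hm.2 with hp | hp | hp
  · obtain ⟨s, hs, hr⟩ : ∃ s : ℤ, (s = 1 ∨ s = -1) ∧ (x + 1 + (y - s) + z) % 4 = 0 := by
      by_cases h : (x + 1 + (y - 1) + z) % 4 = 0
      · exact ⟨1, by omega⟩
      · exact ⟨-1, by omega⟩
    have h := (hstep (x - 1) (y - s) z s (by omega) (by omega) (by omega) (by omega) (by omega)
      (by omega) (by omega) (by omega) (by omega) (by omega) hs).1 (by omega) (by omega)
    rw [show x - 1 + 1 = x by ring, show y - s + s = y by ring,
      show y - s + 2 * s = y + s by ring, show x - 1 + 2 = x + 1 by ring] at h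
    refine ⟨(y + s, x - 1, z), (y - s, x + 1, z), ?_, ?_, ?_⟩
    · simp only [ne_eq, Prod.mk.injEq]; omega
    · rintro ⟨x', y', z'⟩
      simp only [isCentre_b, Near, Prod.mk.injEq]
      rcases hs with rfl | rfl <;> constructor <;> intro h <;> omega
    · rw [hF _ _ _ (by omega) (by omega) (by omega) (by omega) (by omega) (by omega),
        hF _ _ _ (by omega) (by omega) (by omega) (by omega) (by omega) (by omega), h,
        if_congr (show x - 1 = 2 * (d : ℤ) - 2 ↔ x = 2 * d - 1 by omega) rfl rfl, add_assoc,
        CharTwo.add_self_eq_zero, add_zero]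
  · obtain ⟨s, hs, hr⟩ : ∃ s : ℤ, (s = 1 ∨ s = -1) ∧ (x + (y - 1) + (z - s)) % 4 = 2 := by
      by_cases h : (x + (y - 1) + (z - 1)) % 4 = 2
      · exact ⟨1, by omega⟩
      · exact ⟨-1, by omega⟩
    have h := hlayer x (y - 1) (z - s) 1 s (by omega) (by omega) (by omega) (by omega) (by omega)
      (by omega) (Or.inl rfl) hs (by omega) (by omega) (by omega) (by omega)
    rw [show y - 1 + 1 = y by ring, show z - s + s = z by ring,
      show z - s + 2 * s = z + s by ring, show y - 1 + 2 * 1 = y + 1 by ring] at h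
    refine ⟨(y + 1, x, z - s), (y - 1, x, z + s), ?_, ?_, ?_⟩
    · simp only [ne_eq, Prod.mk.injEq]; omega
    · rintro ⟨x', y', z'⟩
      simp only [isCentre_b, Near, Prod.mk.injEq]
      rcases hs with rfl | rfl <;> constructor <;> intro h <;> omega
    · rw [hF _ _ _ (by omega) (by omega) (by omega) (by omega) (by omega) (by omega),
        hF _ _ _ (by omega) (by omega) (by omega) (by omega) (by omega) (by omega), h,
        if_neg (by omega), add_zero]
  · obtain ⟨s, hs, hr⟩ : ∃ s : ℤ, (s = 1 ∨ s = -1) ∧ (x + 1 + y + (z - s)) % 4 = 0 := by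
      by_cases h : (x + 1 + y + (z - 1)) % 4 = 0
      · exact ⟨1, by omega⟩
      · exact ⟨-1, by omega⟩
    have h := (hstep (x - 1) y (z - s) s (by omega) (by omega) (by omega) (by omega) (by omega)
      (by omega) (by omega) (by omega) (by omega) (by omega) hs).2 (by omega) (by omega)
      (by omega) (by omega)
    rw [show x - 1 + 1 = x by ring, show z - s + s = z by ring,
      show z - s + 2 * s = z + s by ring, show x - 1 + 2 = x + 1 by ring] at h
    refine ⟨(y, x - 1, z + s), (y, x + 1, z - s), ?_, ?_, ?_⟩
    · simp only [ne_eq, Prod.mk.injEq]; omega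
    · rintro ⟨x', y', z'⟩
      simp only [isCentre_b, Near, Prod.mk.injEq]
      rcases hs with rfl | rfl <;> constructor <;> intro h <;> omega
    · rw [hF _ _ _ (by omega) (by omega) (by omega) (by omega) (by omega) (by omega),
        hF _ _ _ (by omega) (by omega) (by omega) (by omega) (by omega) (by omega), h,
        if_congr (show x - 1 = 2 * (d : ℤ) - 2 ↔ x = 2 * d - 1 by omega) rfl rfl, add_assoc,
        CharTwo.add_self_eq_zero, add_zero]

theorem closed_g_complete {d : ℕ} (hd : 2 ≤ d) {w : Vertex d → ZMod 2} (hw : Closed d .g w) :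
    ∃ α : ZMod 2, w + α • indicator (boundary d .g true) ∈ xSpan d .g := by
  obtain ⟨f, α, hf0, hf1, hx, hy, hz⟩ := exists_column_potential (d := d)
    (W := fun x y z => extend w (x, y, z)) (plaquette_x_closed hw hd) (plaquette_y_closed hw hd)
    (fun x y => extend_of_notMem w (by rw [mem_vertexSet]; simp only; omega))
    (fun x y => extend_of_notMem w (by rw [mem_vertexSet]; simp only; omega))
  classical
  let F : Pt → ZMod 2 := fun p => if ValidCentre d .g p then f p.1 p.2.1 p.2.2 else 0
  have hF : ∀ x y z : ℤ, 1 ≤ x → x ≤ 2 * d - 1 → 1 ≤ y → y ≤ 2 * d - 1 → F (x, y, z) = f x y z := by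
    intro x y z hx1 hx2 hy1 hy2
    by_cases h : ValidCentre d .g (x, y, z)
    · exact if_pos h
    · rw [show F (x, y, z) = 0 from if_neg h]
      simp only [ValidCentre, InBox] at h
      by_cases h0 : z ≤ -1
      · rw [hf0 x y z h0]
      · rw [hf1 x y z (by omega)]
  refine ⟨α, mem_xSpan_of_potential hd F (fun p hp => if_neg hp) ?_⟩
  rintro ⟨⟨x, y, z⟩, hv⟩
  have hm := hv
  rw [mem_vertexSet] at hm
  simp only at hm
  have hwv : w ⟨(x, y, z), hv⟩ = extend w (x, y, z) := (extend_of_mem w hv).symm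
  have hind : (α • indicator (boundary d .g true)) ⟨(x, y, z), hv⟩ =
      if z = 2 * d - 2 then α else 0 := by
    simp [indicator, mem_boundary_g]
  rw [Pi.add_apply, hwv, hind]
  rcases hm.2 with hp | hp | hp
  · have h := hz x y z (by omega) (by omega) (by omega) (by omega) (by omega) (by omega)
      (by omega) (by omega) (by omega)
    refine ⟨(x, y, z - 1), (x, y, z + 1), ?_, ?_, ?_⟩
    · simp only [ne_eq, Prod.mk.injEq]; omega
    · rintro ⟨x', y', z'⟩
      simp only [isCentre_g, Near, Prod.mk.injEq]
      omega
    · rw [hF _ _ _ (by omega) (by omega) (by omega) (by omega),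
        hF _ _ _ (by omega) (by omega) (by omega) (by omega), h, add_assoc,
        CharTwo.add_self_eq_zero, add_zero]
  · have h := hy x y z (by omega) (by omega) (by omega) (by omega) (by omega) (by omega)
      (by omega) (by omega) (by omega)
    refine ⟨(x, y + 1, z), (x, y - 1, z), ?_, ?_, ?_⟩
    · simp only [ne_eq, Prod.mk.injEq]; omega
    · rintro ⟨x', y', z'⟩
      simp only [isCentre_g, Near, Prod.mk.injEq]
      omega
    · rw [hF _ _ _ (by omega) (by omega) (by omega) (by omega),
        hF _ _ _ (by omega) (by omega) (by omega) (by omega), h, if_neg (by omega), add_zero]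
  · have h := hx x y z (by omega) (by omega) (by omega) (by omega) (by omega) (by omega)
      (by omega) (by omega) (by omega)
    refine ⟨(x + 1, y, z), (x - 1, y, z), ?_, ?_, ?_⟩
    · simp only [ne_eq, Prod.mk.injEq]; omega
    · rintro ⟨x', y', z'⟩
      simp only [isCentre_g, Near, Prod.mk.injEq]
      omega
    · rw [hF _ _ _ (by omega) (by omega) (by omega) (by omega),
        hF _ _ _ (by omega) (by omega) (by omega) (by omega), h, if_neg (by omega), add_zero]

theorem closed_complete {d : ℕ} (hd : 2 ≤ d) {c : Colour} {w : Vertex d → ZMod 2}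
    (hw : Closed d c w) :
    ∃ α : ZMod 2, w + α • indicator (boundary d c true) ∈ xSpan d c := by
  cases c
  · exact closed_r_complete hd hw
  · exact closed_g_complete hd hw
  · exact closed_b_complete hd hw

/-! ### Parity of intersections. -/

/-- The point reflection in `(a, b, c) / 2` acts on `s` without fixed points and pairs off its
elements. -/
theorem card_eq_zero_of_reflection {d : ℕ} {s : Finset (Vertex d)} (P : Pt → Prop) (a b c : ℤ)
    (hs : ∀ v, v ∈ s ↔ P v.1)
    (h : ∀ x y z : ℤ, (x, y, z) ∈ vertexSet d → P (x, y, z) →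
      (a - x, b - y, c - z) ∈ vertexSet d ∧ P (a - x, b - y, c - z) ∧
        ¬ (a - x = x ∧ b - y = y ∧ c - z = z)) :
    (s.card : ZMod 2) = 0 := by
  rw [Finset.cast_card]
  refine Finset.sum_involution
    (fun v hv => ⟨(a - v.1.1, b - v.1.2.1, c - v.1.2.2), (h _ _ _ v.2 ((hs v).1 hv)).1⟩)
    (fun _ _ => by decide) ?_ ?_ ?_
  · intro v hv _ he
    apply (h _ _ _ v.2 ((hs v).1 hv)).2.2
    simpa [Subtype.ext_iff, Prod.ext_iff] using he
  · intro v hv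
    exact (hs _).2 (h _ _ _ v.2 ((hs v).1 hv)).2.1
  · intro v hv
    simp

theorem exists_boundary_r (d : ℕ) (side : Bool) : ∃ x₀ : ℤ, (x₀ = 1 ∨ x₀ = 2 * d - 1) ∧
    ∀ v : Vertex d, v ∈ boundary d .r side ↔ v.1.1 = x₀ :=
  ⟨_, by cases side <;> simp, fun _ => mem_boundary_r⟩

theorem exists_boundary_b (d : ℕ) (side : Bool) : ∃ y₀ : ℤ, (y₀ = 1 ∨ y₀ = 2 * d - 1) ∧
    ∀ v : Vertex d, v ∈ boundary d .b side ↔ v.1.2.1 = y₀ :=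
  ⟨_, by cases side <;> simp, fun _ => mem_boundary_b⟩

theorem exists_boundary_g (d : ℕ) (side : Bool) : ∃ z₀ : ℤ, (z₀ = 0 ∨ z₀ = 2 * d - 2) ∧
    ∀ v : Vertex d, v ∈ boundary d .g side ↔ v.1.2.2 = z₀ :=
  ⟨_, by cases side <;> simp, fun _ => mem_boundary_g⟩

/-! ### Intersections of cells and boundaries -/

theorem midpoint_cases {a b m : ℤ} (ha : a % 2 = 0) (hb : b % 2 = 0) (hm : m % 2 = 1)
    (ham : m - 2 ≤ a ∧ a ≤ m + 2) (hbm : m - 2 ≤ b ∧ b ≤ m + 2) :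
    (a = b ∧ (a + b) / 2 = a ∧ (a = m + 1 ∨ a = m - 1)) ∨
      ((a = m + 1 ∧ b = m - 1 ∨ a = m - 1 ∧ b = m + 1) ∧ (a + b) / 2 = m) := by
  omega

-- Adjacent `r`- and `b`-cells share a square centred at the midpoint `m` of their centres. An
-- octahedron meeting it contains two neighbouring corners of the square, whose sum is `m + o`, so
-- the reflection exchanges them.
set_option maxHeartbeats 2000000 in
theorem card_three_cells {d : ℕ} {p q o : Pt} (hp : IsCentre .r p) (hq : IsCentre .b q)
    (ho : IsCentre .g o)
    (hbox : ∀ v : Pt, IsLatticePoint v → Near v p → Near v q → Near v o → v ∈ vertexSet d) :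
    ((nearSet d p ∩ nearSet d q ∩ nearSet d o).card : ZMod 2) = 0 := by
  rw [isCentre_r] at hp
  rw [isCentre_b] at hq
  rw [isCentre_g] at ho
  refine card_eq_zero_of_reflection (fun v => Near v p ∧ Near v q ∧ Near v o)
    ((p.1 + q.1) / 2 + o.1) ((p.2.1 + q.2.1) / 2 + o.2.1) ((p.2.2 + q.2.2) / 2 + o.2.2) ?_ ?_
  · intro v
    simp only [Finset.mem_inter, mem_nearSet, and_assoc]
  · intro x y z hv h
    have hm := ((mem_vertexSet _ _).1 hv).2
    have key : IsLatticePoint ((p.1 + q.1) / 2 + o.1 - x, (p.2.1 + q.2.1) / 2 + o.2.1 - y,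
        (p.2.2 + q.2.2) / 2 + o.2.2 - z) ∧
        (Near ((p.1 + q.1) / 2 + o.1 - x, (p.2.1 + q.2.1) / 2 + o.2.1 - y,
          (p.2.2 + q.2.2) / 2 + o.2.2 - z) p ∧
        Near ((p.1 + q.1) / 2 + o.1 - x, (p.2.1 + q.2.1) / 2 + o.2.1 - y,
          (p.2.2 + q.2.2) / 2 + o.2.2 - z) q ∧
        Near ((p.1 + q.1) / 2 + o.1 - x, (p.2.1 + q.2.1) / 2 + o.2.1 - y,
          (p.2.2 + q.2.2) / 2 + o.2.2 - z) o) ∧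
        ¬ ((p.1 + q.1) / 2 + o.1 - x = x ∧ (p.2.1 + q.2.1) / 2 + o.2.1 - y = y ∧
          (p.2.2 + q.2.2) / 2 + o.2.2 - z = z) := by
      rw [isLatticePoint_iff]
      simp only [Near] at h ⊢
      simp only at hm
      -- Two odd numbers at distance at most one are equal, as are two even ones: the odd
      -- coordinates of a common vertex come from the octahedron and the even one from both
      -- cuboctahedra.
      have hv' : (x = o.1 ∧ y = o.2.1 ∧ z = p.2.2 ∧ p.2.2 = q.2.2) ∨
          (x = o.1 ∧ z = o.2.2 ∧ y = p.2.1 ∧ p.2.1 = q.2.1) ∨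
          (y = o.2.1 ∧ z = o.2.2 ∧ x = p.1 ∧ p.1 = q.1) := by
        rcases hm with hm | hm | hm
        · exact Or.inl ⟨by omega, by omega, by omega, by omega⟩
        · exact Or.inr (Or.inl ⟨by omega, by omega, by omega, by omega⟩)
        · exact Or.inr (Or.inr ⟨by omega, by omega, by omega, by omega⟩)
      obtain ⟨m₁, hm₁⟩ : ∃ m, (p.1 + q.1) / 2 = m := ⟨_, rfl⟩
      obtain ⟨m₂, hm₂⟩ : ∃ m, (p.2.1 + q.2.1) / 2 = m := ⟨_, rfl⟩
      obtain ⟨m₃, hm₃⟩ : ∃ m, (p.2.2 + q.2.2) / 2 = m := ⟨_, rfl⟩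
      rw [hm₁, hm₂, hm₃]
      have g1 := midpoint_cases hp.1 hq.1 ho.1 (by omega) (by omega)
      have g2 := midpoint_cases hp.2.1 hq.2.1 ho.2.1 (by omega) (by omega)
      have g3 := midpoint_cases hp.2.2.1 hq.2.2.1 ho.2.2 (by omega) (by omega)
      rw [hm₁] at g1
      rw [hm₂] at g2
      rw [hm₃] at g3
      clear h hm hm₁ hm₂ hm₃ hv hbox
      rcases hv' with ⟨rfl, rfl, rfl, he⟩ | ⟨rfl, rfl, rfl, he⟩ | ⟨rfl, rfl, rfl, he⟩ <;>
      rcases g1 with ⟨g1, rfl, g1'⟩ | ⟨g1, rfl⟩ <;> rcases g2 with ⟨g2, rfl, g2'⟩ | ⟨g2, rfl⟩ <;>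
      rcases g3 with ⟨g3, rfl, g3'⟩ | ⟨g3, rfl⟩ <;>
      first
      | (exfalso; omega)
      | (refine ⟨?_, ⟨⟨?_, ?_, ?_⟩, ⟨?_, ?_, ?_⟩, ?_, ?_, ?_⟩, ?_⟩ <;> omega)
    exact ⟨hbox _ key.1 key.2.1.1 key.2.1.2.1 key.2.1.2.2, key.2.1, key.2.2⟩

/-- An `r`-cell and a `b`-cell meet a horizontal plane in an even number of vertices if they may be
reflected in the plane without leaving the box. -/
theorem card_rb_inter_horizontal {d : ℕ} {p q : Pt} (hp : IsCentre .r p) (hq : IsCentre .b q)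
    (hx : p.1 = q.1 → 2 ≤ p.1 ∧ p.1 ≤ 2 * d - 2)
    (hy : p.2.1 = q.2.1 → 2 ≤ p.2.1 ∧ p.2.1 ≤ 2 * d - 2) (side : Bool) :
    ((nearSet d p ∩ nearSet d q ∩ boundary d .g side).card : ZMod 2) = 0 := by
  obtain ⟨z₀, hz₀, hB⟩ := exists_boundary_g d side
  rw [isCentre_r] at hp
  rw [isCentre_b] at hq
  refine card_eq_zero_of_reflection (fun v => Near v p ∧ Near v q ∧ v.2.2 = z₀)
    (p.1 + q.1) (p.2.1 + q.2.1) (2 * z₀) ?_ ?_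
  · intro v
    simp only [Finset.mem_inter, mem_nearSet, and_assoc, hB]
  · intro x y z hv h
    rw [mem_vertexSet] at hv ⊢
    simp only [Near] at hv h ⊢
    have hm : x % 2 = 1 ∧ y % 2 = 1 ∧ z % 2 = 0 := by omega
    -- The two colours force the centres to differ by two in exactly one horizontal coordinate; the
    -- plane then cuts their common square in two opposite corners.
    rcases (show (p.1 = q.1 ∧ (p.2.1 = q.2.1 + 2 ∨ p.2.1 = q.2.1 - 2)) ∨
          (p.2.1 = q.2.1 ∧ (p.1 = q.1 + 2 ∨ p.1 = q.1 - 2)) by omega) with h' | h'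
    · have := hx h'.1
      clear hx hy
      refine ⟨⟨by omega, by omega⟩, by omega, by omega⟩
    · have := hy h'.1
      clear hx hy
      refine ⟨⟨by omega, by omega⟩, by omega, by omega⟩

/-- A cuboctahedron and an octahedron meet a plane `y = y₀` in an even number of vertices if these
vertices may be swapped without leaving the box. -/
theorem card_inter_plane_y {d : ℕ} {p o : Pt} (hp : p.1 % 2 = 0 ∧ p.2.1 % 2 = 0 ∧ p.2.2 % 2 = 0)
    (ho : IsCentre .g o) {y₀ : ℤ} (hy₀ : y₀ % 2 = 1)
    (hbox : ∀ v : Pt, IsLatticePoint v → v.2.1 = y₀ → Near v p → Near v o → v ∈ vertexSet d)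
    {s : Finset (Vertex d)} (hs : ∀ v, v ∈ s ↔ Near v.1 p ∧ Near v.1 o ∧ v.1.2.1 = y₀) :
    (s.card : ZMod 2) = 0 := by
  rw [isCentre_g] at ho
  refine card_eq_zero_of_reflection (fun v => Near v p ∧ Near v o ∧ v.2.1 = y₀)
    (p.1 + o.1) (2 * y₀) (p.2.2 + o.2.2) hs ?_
  intro x y z hv h
  have hm := ((mem_vertexSet _ _).1 hv).2
  have hl := hbox (p.1 + o.1 - x, 2 * y₀ - y, p.2.2 + o.2.2 - z)
  rw [isLatticePoint_iff] at hl
  simp only [Near] at h ⊢ hl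
  simp only at hm
  -- Of the three corners of the triangle only these two have odd second coordinate.
  have hxz : (x = p.1 ∧ z = o.2.2) ∨ (x = o.1 ∧ z = p.2.2) := by omega
  have hrest : y = y₀ ∧ p.2.1 - 1 ≤ y₀ ∧ y₀ ≤ p.2.1 + 1 ∧ o.2.1 = y₀ := by omega
  refine ⟨hl ?_ ?_ ?_ ?_, ⟨?_, ?_, ?_⟩, ?_⟩ <;> clear hl hbox <;> omega

theorem card_inter_plane_x {d : ℕ} {p o : Pt} (hp : p.1 % 2 = 0 ∧ p.2.1 % 2 = 0 ∧ p.2.2 % 2 = 0)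
    (ho : IsCentre .g o) {x₀ : ℤ} (hx₀ : x₀ % 2 = 1)
    (hbox : ∀ v : Pt, IsLatticePoint v → v.1 = x₀ → Near v p → Near v o → v ∈ vertexSet d)
    {s : Finset (Vertex d)} (hs : ∀ v, v ∈ s ↔ Near v.1 p ∧ Near v.1 o ∧ v.1.1 = x₀) :
    (s.card : ZMod 2) = 0 := by
  rw [isCentre_g] at ho
  refine card_eq_zero_of_reflection (fun v => Near v p ∧ Near v o ∧ v.1 = x₀)
    (2 * x₀) (p.2.1 + o.2.1) (p.2.2 + o.2.2) hs ?_
  intro x y z hv h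
  have hm := ((mem_vertexSet _ _).1 hv).2
  have hl := hbox (2 * x₀ - x, p.2.1 + o.2.1 - y, p.2.2 + o.2.2 - z)
  rw [isLatticePoint_iff] at hl
  simp only [Near] at h ⊢ hl
  simp only at hm
  have hyz : (y = p.2.1 ∧ z = o.2.2) ∨ (y = o.2.1 ∧ z = p.2.2) := by omega
  have hrest : x = x₀ ∧ p.1 - 1 ≤ x₀ ∧ x₀ ≤ p.1 + 1 ∧ o.1 = x₀ := by omega
  refine ⟨hl ?_ ?_ ?_ ?_, ⟨?_, ?_, ?_⟩, ?_⟩ <;> clear hl hbox <;> omega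

theorem card_r_inter_bg {d : ℕ} {p : Pt} (hv : ValidCentre d .r p) (hp : IsCentre .r p)
    (side side' : Bool) :
    ((nearSet d p ∩ boundary d .b side ∩ boundary d .g side').card : ZMod 2) = 0 := by
  obtain ⟨y₀, hy₀, hB⟩ := exists_boundary_b d side
  obtain ⟨z₀, hz₀, hB'⟩ := exists_boundary_g d side'
  rw [isCentre_r] at hp
  simp only [ValidCentre] at hv
  refine card_eq_zero_of_reflection (fun v => Near v p ∧ v.2.1 = y₀ ∧ v.2.2 = z₀)
    (2 * p.1) (2 * y₀) (2 * z₀) ?_ ?_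
  · intro v
    simp only [Finset.mem_inter, mem_nearSet, and_assoc, hB, hB']
  · intro x y z hv h
    rw [mem_vertexSet] at hv ⊢
    simp only [Near] at hv h ⊢
    have hm : x % 2 = 1 ∧ y % 2 = 1 ∧ z % 2 = 0 := by omega
    refine ⟨⟨by omega, by omega⟩, by omega, by omega⟩

theorem card_b_inter_rg {d : ℕ} {p : Pt} (hv : ValidCentre d .b p) (hp : IsCentre .b p)
    (side side' : Bool) :
    ((nearSet d p ∩ boundary d .r side ∩ boundary d .g side').card : ZMod 2) = 0 := by
  obtain ⟨x₀, hx₀, hB⟩ := exists_boundary_r d side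
  obtain ⟨z₀, hz₀, hB'⟩ := exists_boundary_g d side'
  rw [isCentre_b] at hp
  simp only [ValidCentre] at hv
  refine card_eq_zero_of_reflection (fun v => Near v p ∧ v.1 = x₀ ∧ v.2.2 = z₀)
    (2 * x₀) (2 * p.2.1) (2 * z₀) ?_ ?_
  · intro v
    simp only [Finset.mem_inter, mem_nearSet, and_assoc, hB, hB']
  · intro x y z hv h
    rw [mem_vertexSet] at hv ⊢
    simp only [Near] at hv h ⊢
    have hm : x % 2 = 1 ∧ y % 2 = 1 ∧ z % 2 = 0 := by omega
    refine ⟨⟨by omega, by omega⟩, by omega, by omega⟩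

theorem card_g_inter_rb {d : ℕ} {p : Pt} (hv : ValidCentre d .g p) (hp : IsCentre .g p)
    (side side' : Bool) :
    ((nearSet d p ∩ boundary d .r side ∩ boundary d .b side').card : ZMod 2) = 0 := by
  obtain ⟨x₀, hx₀, hB⟩ := exists_boundary_r d side
  obtain ⟨y₀, hy₀, hB'⟩ := exists_boundary_b d side'
  rw [isCentre_g] at hp
  simp only [ValidCentre, InBox] at hv
  refine card_eq_zero_of_reflection (fun v => Near v p ∧ v.1 = x₀ ∧ v.2.1 = y₀)
    (2 * x₀) (2 * y₀) (2 * p.2.2) ?_ ?_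
  · intro v
    simp only [Finset.mem_inter, mem_nearSet, and_assoc, hB, hB']
  · intro x y z hv h
    rw [mem_vertexSet] at hv ⊢
    simp only [Near] at hv h ⊢
    have hm : x % 2 = 1 ∧ y % 2 = 1 ∧ z % 2 = 0 := by omega
    refine ⟨⟨by omega, by omega⟩, by omega, by omega⟩

theorem card_three_boundaries {d : ℕ} (hd : 2 ≤ d) (side₁ side₂ side₃ : Bool) :
    (boundary d .r side₁ ∩ boundary d .b side₂ ∩ boundary d .g side₃).card = 1 := by
  obtain ⟨x₀, hx₀, h1⟩ := exists_boundary_r d side₁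
  obtain ⟨y₀, hy₀, h2⟩ := exists_boundary_b d side₂
  obtain ⟨z₀, hz₀, h3⟩ := exists_boundary_g d side₃
  rw [Finset.card_eq_one]
  refine ⟨⟨(x₀, y₀, z₀), ?_⟩, ?_⟩
  · simp only [mem_vertexSet]; omega
  · ext v
    simp only [Finset.mem_inter, Finset.mem_singleton, h1, h2, h3, Subtype.ext_iff, Prod.ext_iff,
      and_assoc]

theorem card_r_inter_b_inter_g {d : ℕ} {p q : Pt} (hp : IsCentre .r p) (hq : IsCentre .b q)
    (hvp : ValidCentre d .r p) (hvq : ValidCentre d .b q) (side : Bool) :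
    ((nearSet d p ∩ nearSet d q ∩ boundary d .g side).card : ZMod 2) = 0 := by
  refine card_rb_inter_horizontal hp hq ?_ ?_ side
  all_goals
    simp only [ValidCentre] at hvp hvq
    omega

theorem card_r_inter_g_inter_b {d : ℕ} {p q : Pt} (hp : IsCentre .r p) (hq : IsCentre .g q)
    (hvp : ValidCentre d .r p) (hvq : ValidCentre d .g q) (side : Bool) :
    ((nearSet d p ∩ nearSet d q ∩ boundary d .b side).card : ZMod 2) = 0 := by
  obtain ⟨y₀, hy₀, hB⟩ := exists_boundary_b d side
  have hp' := (isCentre_r p).1 hp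
  have hq' := (isCentre_g q).1 hq
  simp only [ValidCentre, InBox] at hvp hvq
  refine card_inter_plane_y (p := p) (o := q) (y₀ := y₀) (by omega) hq (by omega) ?_ ?_
  · rintro ⟨x, y, z⟩ hv hy h1 h2
    rw [isLatticePoint_iff] at hv
    simp only [mem_vertexSet, Near] at hv hy h1 h2 ⊢
    have hxz : (x = p.1 ∧ z = q.2.2) ∨ (x = q.1 ∧ z = p.2.2) := by omega
    exact ⟨by omega, hv⟩
  · intro v
    simp only [Finset.mem_inter, mem_nearSet, and_assoc, hB]

theorem card_b_inter_g_inter_r {d : ℕ} {p q : Pt} (hp : IsCentre .b p) (hq : IsCentre .g q)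
    (hvp : ValidCentre d .b p) (hvq : ValidCentre d .g q) (side : Bool) :
    ((nearSet d p ∩ nearSet d q ∩ boundary d .r side).card : ZMod 2) = 0 := by
  obtain ⟨x₀, hx₀, hB⟩ := exists_boundary_r d side
  have hp' := (isCentre_b p).1 hp
  have hq' := (isCentre_g q).1 hq
  simp only [ValidCentre, InBox] at hvp hvq
  refine card_inter_plane_x (p := p) (o := q) (x₀ := x₀) (by omega) hq (by omega) ?_ ?_
  · rintro ⟨x, y, z⟩ hv hx h1 h2
    rw [isLatticePoint_iff] at hv
    simp only [mem_vertexSet, Near] at hv hx h1 h2 ⊢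
    have hyz : (y = p.2.1 ∧ z = q.2.2) ∨ (y = q.2.1 ∧ z = p.2.2) := by omega
    exact ⟨by omega, hv⟩
  · intro v
    simp only [Finset.mem_inter, mem_nearSet, and_assoc, hB]

/-! ### Generators and boundaries are orthogonal to the `Z` generators. -/

theorem sum_indicator {ι : Type} [DecidableEq ι] (s t : Finset ι) :
    ∑ v ∈ s, indicator t v = ((s ∩ t).card : ZMod 2) := by
  rw [Finset.cast_card]
  simp [indicator, Finset.sum_ite_mem]

theorem sum_indicator_mul {ι : Type} [DecidableEq ι] (s t u : Finset ι) :
    ∑ v ∈ s, indicator t v * indicator u v = ((t ∩ u ∩ s).card : ZMod 2) := by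
  rw [Finset.inter_comm, ← sum_indicator]
  refine Finset.sum_congr rfl fun v _ => ?_
  by_cases h1 : v ∈ t <;> by_cases h2 : v ∈ u <;> simp [indicator, h1, h2]

theorem eq_one_of_ne_zero : ∀ {a : ZMod 2}, a ≠ 0 → a = 1 := by decide

/-- A triangle with at least three vertices in the box lies in the box. -/
theorem mem_vertexSet_of_triangle {d : ℕ} {p o : Pt}
    (hp : p.1 % 2 = 0 ∧ p.2.1 % 2 = 0 ∧ p.2.2 % 2 = 0) (ho : IsCentre .g o)
    (h3 : 3 ≤ (nearSet d p ∩ nearSet d o).card) {v : Pt} (hv : IsLatticePoint v)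
    (hvp : Near v p) (hvo : Near v o) : v ∈ vertexSet d := by
  rw [isCentre_g] at ho
  have ho' : o = (p.1 + (o.1 - p.1), p.2.1 + (o.2.1 - p.2.1), p.2.2 + (o.2.2 - p.2.2)) := by
    simp
  have key : ∀ u : Pt, IsLatticePoint u → (Near u p ∧ Near u o ↔
      u ∈ ({(p.1, o.2.1, o.2.2), (o.1, p.2.1, o.2.2), (o.1, o.2.1, p.2.2)} : Finset Pt)) := by
    intro u hu
    have h := near_and_near_iff (q := p) (s₁ := o.1 - p.1) (s₂ := o.2.1 - p.2.1)
      (s₃ := o.2.2 - p.2.2) hu hp.1 hp.2.1 hp.2.2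
      (by unfold Near at hvp hvo; omega) (by unfold Near at hvp hvo; omega)
      (by unfold Near at hvp hvo; omega)
    rw [← ho'] at h
    simpa using h
  have hsub : (nearSet d p ∩ nearSet d o).map (Function.Embedding.subtype _) ⊆
      ({(p.1, o.2.1, o.2.2), (o.1, p.2.1, o.2.2), (o.1, o.2.1, p.2.2)} : Finset Pt) := by
    intro u hu
    obtain ⟨u', hu', rfl⟩ := Finset.mem_map.1 hu
    rw [Finset.mem_inter, mem_nearSet, mem_nearSet] at hu'
    exact (key _ (isLatticePoint_of_vertex u')).1 hu'
  -- The whole triangle has at most three points, so three vertices in the box exhaust it.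
  have heq := Finset.eq_of_subset_of_card_le hsub (by
    rw [Finset.card_map]
    exact Finset.card_le_three.trans h3)
  have hm := (key v hv).1 ⟨hvp, hvo⟩
  rw [← heq] at hm
  obtain ⟨u, -, rfl⟩ := Finset.mem_map.1 hm
  exact u.2

/-- Unlike triangles, squares of the `g`-code may be truncated at the bottom and top. Their corners
on an octahedron centred in the box survive. -/
theorem mem_vertexSet_of_plaquette {d : ℕ} {p q : Pt} (hp : IsCentre .r p) (hq : IsCentre .b q)
    (hb : InBox d p ∨ InBox d q) {o : Pt} (ho : IsCentre .g o) (hob : InBox d o) {v : Pt}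
    (hv : IsLatticePoint v) (hvp : Near v p) (hvq : Near v q) (hvo : Near v o) :
    v ∈ vertexSet d := by
  rw [isCentre_r] at hp
  rw [isCentre_b] at hq
  rw [isCentre_g] at ho
  rw [isLatticePoint_iff] at hv
  rw [mem_vertexSet]
  refine ⟨?_, hv⟩
  unfold InBox at hb hob
  unfold Near at hvp hvq hvo
  rcases hv with hv | hv | hv
  · have : v.1 = o.1 ∧ v.2.1 = o.2.1 ∧ v.2.2 = p.2.2 ∧ v.2.2 = q.2.2 := by omega
    omega
  · have : v.1 = o.1 ∧ v.2.1 = p.2.1 ∧ v.2.1 = q.2.1 ∧ v.2.2 = o.2.2 := by omega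
    omega
  · have : v.1 = p.1 ∧ v.1 = q.1 ∧ v.2.1 = o.2.1 ∧ v.2.2 = o.2.2 := by omega
    omega

theorem closed_nearSet_g {d : ℕ} {o : Pt} (hv : ValidCentre d .g o) (ho : IsCentre .g o) :
    Closed d .g (indicator (nearSet d o)) := by
  rintro s ⟨p, q, hp, hq, hb, rfl, -⟩
  rw [sum_indicator, cell_eq hp, cell_eq hq]
  exact card_three_cells hp hq ho fun v h h1 h2 h3 =>
    mem_vertexSet_of_plaquette hp hq hb ho hv h h1 h2 h3

theorem closed_boundary_g {d : ℕ} (side : Bool) :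
    Closed d .g (indicator (boundary d .g side)) := by
  rintro s ⟨p, q, hp, hq, hb, rfl, h3⟩
  rw [sum_indicator, cell_eq hp, cell_eq hq]
  have hp' := (isCentre_r p).1 hp
  have hq' := (isCentre_b q).1 hq
  unfold InBox at hb
  rw [cell_eq hp, cell_eq hq] at h3
  refine card_rb_inter_horizontal hp hq (fun h => ?_) (fun h => ?_) side <;> clear h3 <;> omega

/-- A weight-two generator lies on the boundary face of one cell `p`. The other cell of that colour
at each end is centred outside the box and is no generator, so any generator contains both ends or
neither. -/
theorem edge_inter_nearSet {d : ℕ} {p q : Pt} {s : Finset (Vertex d)}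
    (hs : s.card = 2) (hsub : s ⊆ nearSet d p)
    (huniq : ∀ v ∈ s, v ∈ nearSet d q → q = p) : ((s ∩ nearSet d q).card : ZMod 2) = 0 := by
  by_cases h : ∃ v ∈ s, v ∈ nearSet d q
  · obtain ⟨v, hv, hvq⟩ := h
    rw [huniq v hv hvq, Finset.inter_eq_left.2 hsub, hs]
    rfl
  · push Not at h
    have : s ∩ nearSet d q = ∅ := by
      ext v
      simp only [Finset.mem_inter, Finset.notMem_empty, iff_false, not_and]
      exact h v
    simp [this]

theorem closed_nearSet_r {d : ℕ} {q : Pt} (hv : ValidCentre d .r q) (hq : IsCentre .r q) :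
    Closed d .r (indicator (nearSet d q)) := by
  rintro s (⟨p, o, hp, ho, -, rfl, h3⟩ | ⟨_, ⟨p, side, hb, hp, rfl, -⟩, _, _, _, _, hs, h2⟩)
  · rw [cell_eq hp, cell_eq ho] at h3
    have hp' := (isCentre_b p).1 hp
    rw [sum_indicator, cell_eq hp, cell_eq ho, Finset.inter_right_comm,
      Finset.inter_comm (nearSet d p)]
    exact card_three_cells hq hp ho fun v h _ h1 h2 =>
      mem_vertexSet_of_triangle ⟨hp'.1, hp'.2.1, hp'.2.2.1⟩ ho h3 h h1 h2
  · rw [sum_indicator]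
    obtain ⟨x₀, hx₀, hB⟩ := exists_boundary_r d side
    have hsub : ∀ v ∈ s, Near v.1 p ∧ v.1.1 = x₀ := by
      intro v hv
      rw [hs, cell_eq hp] at hv
      rw [← hB, ← mem_nearSet]
      exact Finset.mem_inter.1 (Finset.mem_inter.1 hv).1
    refine edge_inter_nearSet (p := p) h2 (fun v hv => mem_nearSet.2 (hsub v hv).1) ?_
    intro v hvs hvq
    obtain ⟨h1, h2⟩ := hsub v hvs
    rw [mem_nearSet] at hvq
    have hl := (mem_vertexSet _ _).1 v.2
    rw [isCentre_r] at hp hq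
    simp only [InBox, Near, ValidCentre] at hb h1 hvq hv
    rw [Prod.ext_iff, Prod.ext_iff]
    omega

theorem closed_nearSet_b {d : ℕ} {q : Pt} (hv : ValidCentre d .b q) (hq : IsCentre .b q) :
    Closed d .b (indicator (nearSet d q)) := by
  rintro s (⟨p, o, hp, ho, -, rfl, h3⟩ | ⟨_, ⟨p, side, hb, hp, rfl, -⟩, _, _, _, _, hs, h2⟩)
  · rw [cell_eq hp, cell_eq ho] at h3
    have hp' := (isCentre_r p).1 hp
    rw [sum_indicator, cell_eq hp, cell_eq ho, Finset.inter_right_comm]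
    exact card_three_cells hp hq ho fun v h h1 _ h2 =>
      mem_vertexSet_of_triangle ⟨hp'.1, hp'.2.1, hp'.2.2.1⟩ ho h3 h h1 h2
  · rw [sum_indicator]
    obtain ⟨y₀, hy₀, hB⟩ := exists_boundary_b d side
    have hsub : ∀ v ∈ s, Near v.1 p ∧ v.1.2.1 = y₀ := by
      intro v hv
      rw [hs, cell_eq hp] at hv
      rw [← hB, ← mem_nearSet]
      exact Finset.mem_inter.1 (Finset.mem_inter.1 hv).1
    refine edge_inter_nearSet (p := p) h2 (fun v hv => mem_nearSet.2 (hsub v hv).1) ?_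
    intro v hvs hvq
    obtain ⟨h1, h2⟩ := hsub v hvs
    rw [mem_nearSet] at hvq
    have hl := (mem_vertexSet _ _).1 v.2
    rw [isCentre_b] at hp hq
    simp only [InBox, Near, ValidCentre] at hb h1 hvq hv
    rw [Prod.ext_iff, Prod.ext_iff]
    omega

theorem edge_inter_boundary {d : ℕ} {c : Colour} {s : Finset (Vertex d)} {side side' : Bool}
    (h2 : s.card = 2) (hs : s ⊆ boundary d c side)
    (hdis : side ≠ side' → Disjoint (boundary d c side) (boundary d c side')) :
    ((s ∩ boundary d c side').card : ZMod 2) = 0 := by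
  by_cases h : side = side'
  · rw [← h, Finset.inter_eq_left.2 hs, h2]
    rfl
  · rw [Finset.disjoint_iff_inter_eq_empty.1 ((hdis h).mono_left hs)]
    rfl

theorem disjoint_boundary {d : ℕ} (hd : 2 ≤ d) {c : Colour} {side side' : Bool}
    (h : side ≠ side') : Disjoint (boundary d c side) (boundary d c side') := by
  rw [Finset.disjoint_left]
  intro v hv hv'
  cases c
  · rw [mem_boundary_r] at hv hv'
    cases side <;> cases side' <;> simp at h hv hv' <;> omega
  · rw [mem_boundary_g] at hv hv'
    cases side <;> cases side' <;> simp at h hv hv' <;> omega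
  · rw [mem_boundary_b] at hv hv'
    cases side <;> cases side' <;> simp at h hv hv' <;> omega

theorem closed_boundary_r {d : ℕ} (hd : 2 ≤ d) (side : Bool) :
    Closed d .r (indicator (boundary d .r side)) := by
  rintro s (⟨p, o, hp, ho, -, rfl, h3⟩ | ⟨_, ⟨p, side', hb, hp, rfl, -⟩, _, _, _, _, hs, h2⟩)
  · rw [cell_eq hp, cell_eq ho] at h3
    have hp' := (isCentre_b p).1 hp
    rw [sum_indicator, cell_eq hp, cell_eq ho]
    obtain ⟨x₀, hx₀, hB⟩ := exists_boundary_r d side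
    refine card_inter_plane_x (p := p) (o := o) (x₀ := x₀) (by omega) ho (by omega) ?_ ?_
    · exact fun v h _ h1 h2 =>
        mem_vertexSet_of_triangle ⟨hp'.1, hp'.2.1, hp'.2.2.1⟩ ho h3 h h1 h2
    · intro v
      simp only [Finset.mem_inter, mem_nearSet, and_assoc, hB]
  · rw [sum_indicator]
    refine edge_inter_boundary (side := side') h2 ?_ (disjoint_boundary hd)
    rw [hs]
    exact Finset.inter_subset_left.trans Finset.inter_subset_right

theorem closed_boundary_b {d : ℕ} (hd : 2 ≤ d) (side : Bool) :
    Closed d .b (indicator (boundary d .b side)) := by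
  rintro s (⟨p, o, hp, ho, -, rfl, h3⟩ | ⟨_, ⟨p, side', hb, hp, rfl, -⟩, _, _, _, _, hs, h2⟩)
  · rw [cell_eq hp, cell_eq ho] at h3
    have hp' := (isCentre_r p).1 hp
    rw [sum_indicator, cell_eq hp, cell_eq ho]
    obtain ⟨y₀, hy₀, hB⟩ := exists_boundary_b d side
    refine card_inter_plane_y (p := p) (o := o) (y₀ := y₀) (by omega) ho (by omega) ?_ ?_
    · exact fun v h _ h1 h2 =>
        mem_vertexSet_of_triangle ⟨hp'.1, hp'.2.1, hp'.2.2.1⟩ ho h3 h h1 h2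
    · intro v
      simp only [Finset.mem_inter, mem_nearSet, and_assoc, hB]
  · rw [sum_indicator]
    refine edge_inter_boundary (side := side') h2 ?_ (disjoint_boundary hd)
    rw [hs]
    exact Finset.inter_subset_left.trans Finset.inter_subset_right

/-- The space of functions orthogonal to all `Z` generators. -/
def closedSubmodule (d : ℕ) (c : Colour) : Submodule (ZMod 2) (Vertex d → ZMod 2) where
  carrier := {w | Closed d c w}
  add_mem' := by
    intro u v hu hv s hs
    simp only [Pi.add_apply, Finset.sum_add_distrib]
    rw [hu s hs, hv s hs, add_zero]
  zero_mem' := by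
    intro s _
    simp
  smul_mem' := by
    intro a u hu s hs
    simp only [Pi.smul_apply, ← Finset.smul_sum]
    rw [hu s hs, smul_zero]

theorem xSpan_le_closedSubmodule {d : ℕ} (hd : 2 ≤ d) (c : Colour) :
    xSpan d c ≤ closedSubmodule d c := by
  rw [xSpan, Submodule.span_le]
  rintro _ ⟨s, hs, rfl⟩
  obtain ⟨q, hv, hq, rfl⟩ := (mem_xGenerators hd).1 hs
  cases c
  · exact closed_nearSet_r hv hq
  · exact closed_nearSet_g hv hq
  · exact closed_nearSet_b hv hq

theorem closed_boundary {d : ℕ} (hd : 2 ≤ d) (c : Colour) (side : Bool) :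
    Closed d c (indicator (boundary d c side)) := by
  cases c
  · exact closed_boundary_r hd side
  · exact closed_boundary_g side
  · exact closed_boundary_b hd side

/-! ### The triple intersection numbers -/

theorem card_xGenerators_inter {d : ℕ} (hd : 2 ≤ d) {c c' c'' : Colour} (h : c ≠ c')
    (h' : c ≠ c'') (h'' : c' ≠ c'') {s s' : Finset (Vertex d)} (hs : s ∈ xGenerators d c)
    (hs' : s' ∈ xGenerators d c') (side : Bool) :
    ((s ∩ s' ∩ boundary d c'' side).card : ZMod 2) = 0 := by
  obtain ⟨p, hvp, hp, rfl⟩ := (mem_xGenerators hd).1 hs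
  obtain ⟨q, hvq, hq, rfl⟩ := (mem_xGenerators hd).1 hs'
  cases c <;> cases c' <;> cases c'' <;> try contradiction
  · exact card_r_inter_g_inter_b hp hq hvp hvq side
  · exact card_r_inter_b_inter_g hp hq hvp hvq side
  · rw [Finset.inter_comm (nearSet d p)]
    exact card_r_inter_g_inter_b hq hp hvq hvp side
  · rw [Finset.inter_comm (nearSet d p)]
    exact card_b_inter_g_inter_r hq hp hvq hvp side
  · rw [Finset.inter_comm (nearSet d p)]
    exact card_r_inter_b_inter_g hq hp hvq hvp side
  · exact card_b_inter_g_inter_r hp hq hvp hvq side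

theorem card_xGenerators_inter_boundary {d : ℕ} (hd : 2 ≤ d) {c c' c'' : Colour} (h : c ≠ c')
    (h' : c ≠ c'') (h'' : c' ≠ c'') {s : Finset (Vertex d)} (hs : s ∈ xGenerators d c)
    (side side' : Bool) :
    ((s ∩ boundary d c' side ∩ boundary d c'' side').card : ZMod 2) = 0 := by
  obtain ⟨p, hvp, hp, rfl⟩ := (mem_xGenerators hd).1 hs
  cases c <;> cases c' <;> cases c'' <;> try contradiction
  · rw [Finset.inter_right_comm]
    exact card_r_inter_bg hvp hp _ _
  · exact card_r_inter_bg hvp hp _ _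
  · exact card_g_inter_rb hvp hp _ _
  · rw [Finset.inter_right_comm]
    exact card_g_inter_rb hvp hp _ _
  · exact card_b_inter_rg hvp hp _ _
  · rw [Finset.inter_right_comm]
    exact card_b_inter_rg hvp hp _ _

theorem card_boundary_inter {d : ℕ} (hd : 2 ≤ d) {c c' c'' : Colour} (h : c ≠ c')
    (h' : c ≠ c'') (h'' : c' ≠ c'') (side side' side'' : Bool) :
    (boundary d c side ∩ boundary d c' side' ∩ boundary d c'' side'').card = 1 := by
  have key := card_three_boundaries hd
  cases c <;> cases c' <;> cases c'' <;> try contradiction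
  · rw [Finset.inter_right_comm]; exact key _ _ _
  · exact key _ _ _
  · rw [Finset.inter_comm (boundary d .g side), Finset.inter_right_comm]; exact key _ _ _
  · rw [Finset.inter_assoc, Finset.inter_comm, Finset.inter_comm (boundary d .b side')]
    exact key _ _ _
  · rw [Finset.inter_comm (boundary d .b side)]; exact key _ _ _
  · rw [Finset.inter_comm, ← Finset.inter_assoc]; exact key _ _ _

/-- The bilinear form `∑ v ∈ s, u v * w v`. -/
def pairing {ι : Type} (s : Finset ι) (w : ι → ZMod 2) : (ι → ZMod 2) →ₗ[ZMod 2] ZMod 2 where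
  toFun u := ∑ v ∈ s, u v * w v
  map_add' u u' := by simp only [Pi.add_apply, add_mul, Finset.sum_add_distrib]
  map_smul' a u := by
    simp only [Pi.smul_apply, smul_eq_mul, mul_assoc, Finset.mul_sum, RingHom.id_apply]

theorem pairing_comm {ι : Type} (s : Finset ι) (u w : ι → ZMod 2) :
    pairing s w u = pairing s u w :=
  Finset.sum_congr rfl fun _ _ => mul_comm _ _

theorem pairing_indicator {ι : Type} [DecidableEq ι] (s t u : Finset ι) :
    pairing s (indicator u) (indicator t) = ((t ∩ u ∩ s).card : ZMod 2) :=
  sum_indicator_mul s t u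

theorem pairing_xSpan_eq_zero {d : ℕ} {c : Colour} {s : Finset (Vertex d)} {w : Vertex d → ZMod 2}
    (h : ∀ t ∈ xGenerators d c, pairing s w (indicator t) = 0) {u : Vertex d → ZMod 2}
    (hu : u ∈ xSpan d c) : pairing s w u = 0 := by
  have hle : xSpan d c ≤ LinearMap.ker (pairing s w) := by
    rw [xSpan, Submodule.span_le]
    rintro _ ⟨t, ht, rfl⟩
    exact h t ht
  exact hle hu

theorem pairing_xSpan_boundary {d : ℕ} (hd : 2 ≤ d) {c c' c'' : Colour} (h : c ≠ c')
    (h' : c ≠ c'') (h'' : c' ≠ c'') (side side' : Bool) {u : Vertex d → ZMod 2}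
    (hu : u ∈ xSpan d c) :
    pairing (boundary d c'' side') (indicator (boundary d c' side)) u = 0 := by
  refine pairing_xSpan_eq_zero (fun t ht => ?_) hu
  exact (pairing_indicator _ _ _).trans
    (card_xGenerators_inter_boundary hd h h' h'' ht side side')

theorem pairing_xSpan_xSpan {d : ℕ} (hd : 2 ≤ d) {c c' c'' : Colour} (h : c ≠ c')
    (h' : c ≠ c'') (h'' : c' ≠ c'') (side : Bool) {u u' : Vertex d → ZMod 2}
    (hu : u ∈ xSpan d c) (hu' : u' ∈ xSpan d c') :
    pairing (boundary d c'' side) u' u = 0 := by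
  refine pairing_xSpan_eq_zero (fun t ht => ?_) hu
  rw [pairing_comm]
  refine pairing_xSpan_eq_zero (fun t' ht' => ?_) hu'
  rw [pairing_comm]
  exact (pairing_indicator _ _ _).trans (card_xGenerators_inter hd h h' h'' ht ht' side)

theorem pairing_boundary_boundary {d : ℕ} (hd : 2 ≤ d) {c c' c'' : Colour} (h : c ≠ c')
    (h' : c ≠ c'') (h'' : c' ≠ c'') (side side' side'' : Bool) :
    pairing (boundary d c'' side'') (indicator (boundary d c' side'))
      (indicator (boundary d c side)) = 1 := by
  rw [pairing_indicator]
  rw [card_boundary_inter hd h h' h'', Nat.cast_one]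

/-! ### Closed strings as a disjoint union of two cosets. -/

theorem exists_two_other_colours (c : Colour) : ∃ c' c'' : Colour, c ≠ c' ∧ c ≠ c'' ∧ c' ≠ c'' := by
  revert c
  decide

/-- The line where boundaries of the other two colours meet supports a logical `Z`: it meets each
generator evenly but the `c`-boundary in a single corner. -/
theorem boundary_notMem_xSpan {d : ℕ} (hd : 2 ≤ d) (c : Colour) (side : Bool) :
    indicator (boundary d c side) ∉ xSpan d c := by
  intro hmem
  obtain ⟨c', c'', h, h', h''⟩ := exists_two_other_colours c
  have h0 := pairing_xSpan_boundary hd h h' h'' true true hmem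
  rw [pairing_boundary_boundary hd h h' h''] at h0
  exact one_ne_zero h0

theorem mem_coset {d : ℕ} {c : Colour} {side : Bool} {α : ZMod 2} {w : Vertex d → ZMod 2} :
    w ∈ coset d c side α ↔ ∃ v ∈ xSpan d c, w = α • indicator (boundary d c side) + v := by
  classical
  simp [coset]

/-- By bilinearity the sum splits into four terms; only the one with both boundaries survives, and
it counts the single corner. -/
theorem pairing_coset {d : ℕ} (hd : 2 ≤ d) {c c' c'' : Colour} (h : c ≠ c')
    (h' : c ≠ c'') (h'' : c' ≠ c'') {side side' side'' : Bool} {α β : ZMod 2}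
    {w w' : Vertex d → ZMod 2} (hw : w ∈ coset d c side α) (hw' : w' ∈ coset d c' side' β) :
    ∑ v ∈ boundary d c'' side'', w v * w' v = α * β := by
  obtain ⟨u, hu, rfl⟩ := mem_coset.1 hw
  obtain ⟨u', hu', rfl⟩ := mem_coset.1 hw'
  change pairing (boundary d c'' side'') _ _ = _
  rw [map_add, map_smul, pairing_comm _ (indicator (boundary d c side)), pairing_comm _ u,
    map_add, map_add, map_smul, map_smul, pairing_comm _ (indicator (boundary d c' side')),
    pairing_boundary_boundary hd h h' h'', pairing_xSpan_boundary hd h.symm h'' h' _ _ hu',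
    pairing_comm _ (indicator (boundary d c' side')), pairing_xSpan_boundary hd h h' h'' _ _ hu,
    pairing_comm _ u', pairing_xSpan_xSpan hd h h' h'' _ hu hu']
  simp

theorem closed_iff {d : ℕ} (hd : 2 ≤ d) {c : Colour} (side : Bool) {w : Vertex d → ZMod 2} :
    Closed d c w ↔ ∃ α, w ∈ coset d c side α := by
  constructor
  · intro hw
    obtain ⟨α, hα⟩ := closed_complete hd hw
    -- `closed_complete` is stated for the side `true`. Applied to the chosen boundary itself, it
    -- shows that opposite boundaries agree modulo the `X` span.
    obtain ⟨β, hβ⟩ := closed_complete hd (closed_boundary hd c side)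
    have hβ1 : β ≠ 0 := by
      rintro rfl
      rw [zero_smul, add_zero] at hβ
      exact boundary_notMem_xSpan hd c side hβ
    have hβ2 : β = 1 := eq_one_of_ne_zero hβ1
    rw [hβ2, one_smul] at hβ
    refine ⟨α, mem_coset.2 ⟨_, Submodule.add_mem _ hα (Submodule.smul_mem _ α hβ), ?_⟩⟩
    ext v
    simp only [Pi.add_apply, Pi.smul_apply, smul_eq_mul]
    linear_combination - (α * indicator (boundary d c side) v +
      α * indicator (boundary d c true) v) * zmod_two_eq_zero
  · rintro ⟨α, hw⟩
    obtain ⟨u, hu, rfl⟩ := mem_coset.1 hw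
    exact Submodule.add_mem (closedSubmodule d c)
      (Submodule.smul_mem _ _ (closed_boundary hd c side)) (xSpan_le_closedSubmodule hd c hu)

theorem eq_of_mem_coset {d : ℕ} (hd : 2 ≤ d) {c : Colour} {side : Bool} {α β : ZMod 2}
    {w : Vertex d → ZMod 2} (hα : w ∈ coset d c side α) (hβ : w ∈ coset d c side β) : α = β := by
  obtain ⟨u, hu, hw⟩ := mem_coset.1 hα
  obtain ⟨u', hu', hw'⟩ := mem_coset.1 hβ
  by_contra hne
  have h1 : α - β = 1 := eq_one_of_ne_zero (sub_ne_zero.2 hne)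
  apply boundary_notMem_xSpan hd c side
  have : indicator (boundary d c side) = u' - u := by
    rw [← one_smul (ZMod 2) (indicator (boundary d c side)), ← h1, sub_smul]
    rw [hw] at hw'
    rw [sub_eq_sub_iff_add_eq_add, hw', add_comm]
  rw [this]
  exact Submodule.sub_mem _ hu' hu

/-! ### Signs and the action of the operators on amplitudes. -/

/-- The sign `(-1) ^ a`. -/
noncomputable def sign (a : ZMod 2) : ℂ := if a = 1 then -1 else 1

theorem sign_add : ∀ a b : ZMod 2, sign (a + b) = sign a * sign b := by
  intro a b
  by_cases ha : a = 0 <;> by_cases hb : b = 0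
  · simp [sign, ha, hb]
  · simp [sign, ha, eq_one_of_ne_zero hb]
  · simp [sign, hb, eq_one_of_ne_zero ha]
  · rw [eq_one_of_ne_zero ha, eq_one_of_ne_zero hb, show (1 + 1 : ZMod 2) = 0 from rfl]
    simp [sign]

theorem sign_sum {ι : Type*} (s : Finset ι) (f : ι → ZMod 2) :
    sign (∑ i ∈ s, f i) = ∏ i ∈ s, sign (f i) := by
  classical
  induction s using Finset.induction_on with
  | empty => simp [sign]
  | insert a s ha ih => rw [Finset.sum_insert ha, Finset.prod_insert ha, sign_add, ih]

theorem sign_eq_one_iff {a : ZMod 2} : sign a = 1 ↔ a = 0 := by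
  by_cases ha : a = 0
  · simp [sign, ha]
  · rw [eq_one_of_ne_zero ha]
    norm_num [sign]

theorem sign_mul_ite (a b : ZMod 2) : (if a = 1 ∧ b = 1 then (-1 : ℂ) else 1) = sign (a * b) := by
  by_cases ha : a = 0
  · simp [sign, ha]
  · rw [eq_one_of_ne_zero ha]
    simp [sign]

section Operators

variable {ι : Type} [Fintype ι] [DecidableEq ι]

theorem diagonalOp_apply (f : (ι → ZMod 2) → ℂ) (ψ : QState ι) (x : ι → ZMod 2) :
    diagonalOp f ψ x = f x * ψ x := rfl

theorem czGate_apply (i j : ι) (ψ : QState ι) (x : ι → ZMod 2) :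
    czGate i j ψ x = sign (x i * x j) * ψ x := by
  rw [czGate, diagonalOp_apply, sign_mul_ite]

theorem pauliX_apply (s : Finset ι) (ψ : QState ι) (x : ι → ZMod 2) :
    pauliX s ψ x = ψ (x + indicator s) := rfl

theorem pauliZ_apply (s : Finset ι) (ψ : QState ι) (x : ι → ZMod 2) :
    pauliZ s ψ x = sign (∑ i ∈ s, x i) * ψ x := by
  rw [sign_sum]
  rfl

end Operators

/-! ### Amplitudes of the encoded states. -/

section Stack

variable {d : ℕ}

theorem noncommProd_czGate_apply (c c' : Colour) (s : Finset (Vertex d))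
    (hs : (s : Set (Vertex d)).Pairwise
      (Function.onFun Commute fun v => czGate ((c, v) : Qubit d) (c', v)))
    (ψ : QState (Qubit d)) (x : Qubit d → ZMod 2) :
    s.noncommProd (fun v => czGate ((c, v) : Qubit d) (c', v)) hs ψ x =
      sign (∑ v ∈ s, x (c, v) * x (c', v)) * ψ x := by
  induction s using Finset.induction_on with
  | empty => simp [sign]
  | insert a s ha ih =>
    rw [Finset.noncommProd_insert_of_notMem _ _ _ _ ha, Module.End.mul_apply, czGate_apply, ih,
      Finset.sum_insert ha, sign_add, mul_assoc]

theorem transversalCZ_apply (c c' : Colour) (s : Finset (Vertex d)) (ψ : QState (Qubit d))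
    (x : Qubit d → ZMod 2) :
    transversalCZ d c c' s ψ x = sign (∑ v ∈ s, x (c, v) * x (c', v)) * ψ x :=
  noncommProd_czGate_apply c c' s _ ψ x

open Classical in
theorem codeKet_apply (c : Colour) (side : Bool) (α : ZMod 2) (w : Vertex d → ZMod 2) :
    codeKet d c side α w = if w ∈ coset d c side α then
      ((Real.sqrt (coset d c side α).card : ℂ))⁻¹ else 0 := by
  simp [codeKet, ket, Finset.sum_apply, Pi.single_apply, WithLp.ofLp_sum]

theorem stackKet_apply (side : Colour → Bool) (α : Colour → ZMod 2) (x : Qubit d → ZMod 2) :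
    stackKet d side α x = ∏ c, codeKet d c (side c) (α c) fun v => x (c, v) := rfl

/-- Every component of `x` lies in the coset selected by `α`. -/
def InCosets (d : ℕ) (side : Colour → Bool) (α : Colour → ZMod 2) (x : Qubit d → ZMod 2) : Prop :=
  ∀ c, (fun v => x (c, v)) ∈ coset d c (side c) (α c)

theorem coset_nonempty (c : Colour) (side : Bool) (α : ZMod 2) :
    (coset d c side α).Nonempty :=
  ⟨_, mem_coset.2 ⟨0, Submodule.zero_mem _, rfl⟩⟩

/-- The common amplitude of the bit strings in an encoded basis state. -/
noncomputable def amplitude (d : ℕ) (side : Colour → Bool) (α : Colour → ZMod 2) : ℂ :=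
  ∏ c, ((Real.sqrt (coset d c (side c) (α c)).card : ℂ))⁻¹

theorem amplitude_ne_zero (side : Colour → Bool) (α : Colour → ZMod 2) :
    amplitude d side α ≠ 0 := by
  refine Finset.prod_ne_zero_iff.2 fun c _ => inv_ne_zero ?_
  rw [Complex.ofReal_ne_zero, Real.sqrt_ne_zero']
  exact_mod_cast Finset.card_pos.2 (coset_nonempty c (side c) (α c))

theorem stackKet_of_inCosets {side : Colour → Bool} {α : Colour → ZMod 2}
    {x : Qubit d → ZMod 2} (h : InCosets d side α x) :
    stackKet d side α x = amplitude d side α := by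
  rw [stackKet_apply]
  refine Finset.prod_congr rfl fun c _ => ?_
  rw [codeKet_apply, if_pos (h c)]

theorem stackKet_of_not_inCosets {side : Colour → Bool} {α : Colour → ZMod 2}
    {x : Qubit d → ZMod 2} (h : ¬ InCosets d side α x) : stackKet d side α x = 0 := by
  unfold InCosets at h
  push Not at h
  obtain ⟨c, hc⟩ := h
  rw [stackKet_apply]
  refine Finset.prod_eq_zero (Finset.mem_univ c) ?_
  rw [codeKet_apply, if_neg hc]

theorem inCosets_unique (hd : 2 ≤ d) {side : Colour → Bool} {α β : Colour → ZMod 2}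
    {x : Qubit d → ZMod 2} (hα : InCosets d side α x) (hβ : InCosets d side β x) : α = β :=
  funext fun c => eq_of_mem_coset hd (hα c) (hβ c)

theorem norm_codeKet (c : Colour) (side : Bool) (α : ZMod 2) :
    ∑ w, ‖codeKet d c side α w‖ ^ 2 = 1 := by
  classical
  have hpos : (0 : ℝ) < (coset d c side α).card := by
    exact_mod_cast Finset.card_pos.2 (coset_nonempty c side α)
  have h : ∀ w, ‖codeKet d c side α w‖ ^ 2 =
      if w ∈ coset d c side α then ((coset d c side α).card : ℝ)⁻¹ else 0 := by
    intro w
    rw [codeKet_apply]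
    split_ifs
    · rw [norm_inv, Complex.norm_real, inv_pow, Real.norm_eq_abs, sq_abs,
        Real.sq_sqrt hpos.le]
    · simp
  simp only [h, Finset.sum_ite_mem, Finset.univ_inter, Finset.sum_const, nsmul_eq_mul]
  exact mul_inv_cancel₀ hpos.ne'

theorem norm_stackKet (side : Colour → Bool) (α : Colour → ZMod 2) :
    ‖stackKet d side α‖ = 1 := by
  have h : ‖stackKet d side α‖ ^ 2 = 1 := by
    rw [EuclideanSpace.norm_sq_eq]
    -- A string of the stack is a triple of strings, one per code, so the squared norm factorises.
    rw [← (Equiv.curry Colour (Vertex d) (ZMod 2)).symm.sum_comp]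
    have : ∀ y : Colour → Vertex d → ZMod 2,
        ‖stackKet d side α ((Equiv.curry Colour (Vertex d) (ZMod 2)).symm y)‖ ^ 2 =
          ∏ c, ‖codeKet d c (side c) (α c) (y c)‖ ^ 2 := by
      intro y
      rw [stackKet_apply, norm_prod, Finset.prod_pow]
      rfl
    simp only [this]
    rw [← Fintype.prod_sum (fun c w => ‖codeKet d c (side c) (α c) w‖ ^ 2)]
    simp [norm_codeKet]
  exact (pow_eq_one_iff_of_nonneg (norm_nonneg _) two_ne_zero).1 h

/-- Different labels select disjoint products of cosets, so the states have disjoint supports. -/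
theorem orthonormal_stackKet (hd : 2 ≤ d) (side : Colour → Bool) :
    Orthonormal ℂ (stackKet d side) := by
  refine ⟨norm_stackKet side, fun α β hne => ?_⟩
  change inner ℂ (stackKet d side α) (stackKet d side β) = 0
  rw [PiLp.inner_apply]
  refine Finset.sum_eq_zero fun x _ => ?_
  by_cases hα : InCosets d side α x
  · have hβ : ¬ InCosets d side β x := fun hβ => hne (inCosets_unique hd hα hβ)
    rw [stackKet_of_not_inCosets hβ, inner_zero_right]
  · rw [stackKet_of_not_inCosets hα, inner_zero_left]

/-! ### The code space -/

theorem mem_codeSpace {ψ : QState (Qubit d)} : ψ ∈ codeSpace d ↔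
    ∀ c, (∀ s ∈ xGenerators d c, pauliX ({c} ×ˢ s) ψ = ψ) ∧
      (∀ s ∈ zGenerators d c, pauliZ ({c} ×ˢ s) ψ = ψ) := by
  simp [codeSpace, Submodule.mem_iInf, LinearMap.mem_eqLocus]

/-- The inclusion of the bit strings of one code in those of the stack. -/
def embed (d : ℕ) (c : Colour) : (Vertex d → ZMod 2) →ₗ[ZMod 2] (Qubit d → ZMod 2) where
  toFun u q := if q.1 = c then u q.2 else 0
  map_add' u u' := by ext q; by_cases h : q.1 = c <;> simp [h]
  map_smul' a u := by ext q; by_cases h : q.1 = c <;> simp [h]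

theorem embed_indicator (c : Colour) (s : Finset (Vertex d)) :
    embed d c (indicator s) = indicator ({c} ×ˢ s) := by
  ext ⟨c', v⟩
  by_cases h : c' = c <;> simp [embed, indicator, h, eq_comm (a := c)]

/-- The bit strings by which `ψ` may be translated. -/
def invariances (ψ : QState (Qubit d)) : AddSubgroup (Qubit d → ZMod 2) where
  carrier := {u | ∀ x, ψ (x + u) = ψ x}
  add_mem' := by
    intro u v hu hv x
    rw [← add_assoc, hv, hu]
  zero_mem' := by simp
  neg_mem' := by
    intro u hu x
    rw [← hu (x + -u), neg_add_cancel_right]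

theorem embed_mem_invariances {ψ : QState (Qubit d)} {c : Colour}
    (h : ∀ s ∈ xGenerators d c, pauliX ({c} ×ˢ s) ψ = ψ) {u : Vertex d → ZMod 2}
    (hu : u ∈ xSpan d c) : embed d c u ∈ invariances ψ := by
  induction hu using Submodule.span_induction with
  | mem u hu =>
    obtain ⟨s, hs, rfl⟩ := hu
    intro x
    rw [embed_indicator, ← pauliX_apply, h s hs]
  | zero => rw [map_zero]; exact zero_mem _
  | add u v _ _ hu hv => rw [map_add]; exact add_mem hu hv
  | smul a u _ hu =>
    by_cases ha : a = 0
    · rw [ha, zero_smul, map_zero]; exact zero_mem _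
    · rw [eq_one_of_ne_zero ha, one_smul]; exact hu

theorem sum_singleton_product (c : Colour) (s : Finset (Vertex d)) (x : Qubit d → ZMod 2) :
    ∑ q ∈ ({c} ×ˢ s : Finset (Qubit d)), x q = ∑ v ∈ s, x (c, v) := by
  rw [Finset.sum_product, Finset.sum_singleton]

/-- A `Z` generator multiplies the amplitude at `x` by a sign, which must be `1` where the amplitude
is nonzero. -/
theorem closed_of_apply_ne_zero {ψ : QState (Qubit d)} (hψ : ψ ∈ codeSpace d)
    {x : Qubit d → ZMod 2} (hx : ψ x ≠ 0) (c : Colour) : Closed d c (fun v => x (c, v)) := by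
  intro s hs
  have h := congrArg (fun φ : QState (Qubit d) => φ x) ((mem_codeSpace.1 hψ c).2 s hs)
  simp only [pauliZ_apply, sum_singleton_product] at h
  exact sign_eq_one_iff.1 (mul_right_cancel₀ hx (h.trans (one_mul _).symm))

/-- A bit string in the cosets selected by `α`. -/
noncomputable def representative (d : ℕ) (side : Colour → Bool) (α : Colour → ZMod 2) :
    Qubit d → ZMod 2 :=
  fun q => α q.1 * indicator (boundary d q.1 (side q.1)) q.2

/-- The `X` stabilizers make `ψ` invariant under translation by the `X` spans, and these act
transitively on a product of cosets. -/
theorem apply_eq_apply_representative {ψ : QState (Qubit d)} (hψ : ψ ∈ codeSpace d)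
    {side : Colour → Bool} {α : Colour → ZMod 2} {x : Qubit d → ZMod 2}
    (hx : InCosets d side α x) : ψ x = ψ (representative d side α) := by
  choose u hu hxu using fun c => mem_coset.1 (hx c)
  have hsum : x = representative d side α + ∑ c, embed d c (u c) := by
    ext ⟨c, v⟩
    have h := congrFun (hxu c) v
    simp only [Pi.add_apply, Pi.smul_apply, smul_eq_mul] at h
    simp [h, representative, embed, Finset.sum_apply]
  have hmem : ∑ c, embed d c (u c) ∈ invariances ψ :=
    sum_mem fun c _ => embed_mem_invariances (mem_codeSpace.1 hψ c).1 (hu c)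
  rw [hsum]
  exact hmem _

theorem codeSpace_le_span (hd : 2 ≤ d) (side : Colour → Bool) :
    codeSpace d ≤ Submodule.span ℂ (Set.range (stackKet d side)) := by
  intro ψ hψ
  -- The coefficient is the constant value of `ψ` on the product of cosets, divided by the amplitude
  -- of the basis state.
  have hsum : ψ = ∑ α, (ψ (representative d side α) * (amplitude d side α)⁻¹) •
      stackKet d side α := by
    ext x
    simp only [WithLp.ofLp_sum, WithLp.ofLp_smul, Finset.sum_apply, Pi.smul_apply, smul_eq_mul]
    by_cases hx : ∃ α, InCosets d side α x
    · obtain ⟨α, hα⟩ := hx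
      rw [Finset.sum_eq_single α]
      · rw [stackKet_of_inCosets hα, apply_eq_apply_representative hψ hα, mul_assoc,
          inv_mul_cancel₀ (amplitude_ne_zero side α), mul_one]
      · intro β _ hβ
        rw [stackKet_of_not_inCosets fun h => hβ (inCosets_unique hd h hα), mul_zero]
      · simp
    · push Not at hx
      rw [Finset.sum_eq_zero fun α _ => by rw [stackKet_of_not_inCosets (hx α), mul_zero]]
      by_contra hne
      choose α hα using fun c => (closed_iff hd (side c)).1 (closed_of_apply_ne_zero hψ hne c)
      exact hx α hα
  rw [hsum]
  exact Submodule.sum_mem _ fun α _ =>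
    Submodule.smul_mem _ _ (Submodule.subset_span (Set.mem_range_self α))

theorem inCosets_add_indicator {side : Colour → Bool} {α : Colour → ZMod 2} {c : Colour}
    {s : Finset (Vertex d)} (hs : s ∈ xGenerators d c) {x : Qubit d → ZMod 2}
    (hx : InCosets d side α x) : InCosets d side α (x + indicator ({c} ×ˢ s)) := by
  intro c'
  obtain ⟨u, hu, hxu⟩ := mem_coset.1 (hx c')
  by_cases h : c' = c
  · subst h
    refine mem_coset.2 ⟨u + indicator s, Submodule.add_mem _ hu
      (Submodule.subset_span ⟨s, hs, rfl⟩), ?_⟩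
    rw [← add_assoc, ← hxu]
    ext v
    simp [indicator]
  · refine mem_coset.2 ⟨u, hu, ?_⟩
    rw [← hxu]
    ext v
    simp [indicator, h, eq_comm (a := c)]

theorem stackKet_mem_codeSpace (hd : 2 ≤ d) (side : Colour → Bool) (α : Colour → ZMod 2) :
    stackKet d side α ∈ codeSpace d := by
  refine mem_codeSpace.2 fun c => ⟨fun s hs => ?_, fun s hs => ?_⟩
  · ext x
    rw [pauliX_apply]
    by_cases hx : InCosets d side α x
    · rw [stackKet_of_inCosets hx, stackKet_of_inCosets (inCosets_add_indicator hs hx)]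
    · rw [stackKet_of_not_inCosets hx, stackKet_of_not_inCosets]
      intro h
      apply hx
      have h2 := inCosets_add_indicator hs h
      have h0 : ∀ u : Qubit d → ZMod 2, u + u = 0 := fun u =>
        funext fun q => CharTwo.add_self_eq_zero (u q)
      rwa [add_assoc, h0, add_zero] at h2
  · ext x
    rw [pauliZ_apply, sum_singleton_product]
    by_cases hx : InCosets d side α x
    · rw [(closed_iff hd (side c)).2 ⟨α c, hx c⟩ s hs, sign_eq_one_iff.2 rfl, one_mul]
    · rw [stackKet_of_not_inCosets hx, mul_zero]

/-! ### The transversal gate -/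

theorem transversalCZ_stackKet (hd : 2 ≤ d) (side : Colour → Bool) {c c' c'' : Colour}
    (h : c ≠ c') (h' : c ≠ c'') (h'' : c' ≠ c'') (α : Colour → ZMod 2) :
    transversalCZ d c c' (boundary d c'' (side c'')) (stackKet d side α) =
      sign (α c * α c') • stackKet d side α := by
  ext x
  rw [transversalCZ_apply, WithLp.ofLp_smul, Pi.smul_apply, smul_eq_mul]
  by_cases hx : InCosets d side α x
  · rw [pairing_coset hd h h' h'' (hx c) (hx c')]
  · rw [stackKet_of_not_inCosets hx, mul_zero, mul_zero]

theorem encode_apply (side : Colour → Bool) (φ : QState Colour) :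
    encode d side φ = ∑ α : Colour → ZMod 2, φ α • stackKet d side α := rfl

end Stack

end StackedCode

open StackedCode

theorem mainTheorem2 (d : ℕ) (hd : 2 ≤ d) (side : Colour → Bool) :
    Orthonormal ℂ (stackKet d side) ∧
    Submodule.span ℂ (Set.range (stackKet d side)) = codeSpace d ∧
    ∀ c c' c'' : Colour, c ≠ c' → c ≠ c'' → c' ≠ c'' → ∀ φ : QState Colour,
      transversalCZ d c c' (boundary d c'' (side c'')) (encode d side φ) =
        encode d side (czGate c c' φ) := by
  refine ⟨orthonormal_stackKet hd side, le_antisymm ?_ (codeSpace_le_span hd side), ?_⟩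
  · rw [Submodule.span_le]
    rintro _ ⟨α, rfl⟩
    exact stackKet_mem_codeSpace hd side α
  · intro c c' c'' h h' h'' φ
    rw [encode_apply, encode_apply, map_sum]
    refine Finset.sum_congr rfl fun α _ => ?_
    rw [map_smul, transversalCZ_stackKet hd side h h' h'', czGate_apply, smul_smul, mul_comm]
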